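/- Let $n\ge 2$ and let $\mathcal D$ be an $n$-dimensional Delaunay unduloid with weight parameter $\mu>0$ and constant normalized mean curvature $H$, of one of the following two kinds. (Euclidean, $H=1$.) $\mathcal D\subset\mathbb R^{n+1}$ is the hypersurface of revolution $\{(x,f(x)\omega): x\in\mathbb R,\ \omega\in S^{n-1}\}$ with constant mean curvature $1$, where $f:\mathbb R\to(0,\infty)$ is smooth and $$\mu=\frac{f^{n-1}}{\sqrt{1+f'^2}}-f^n .$$ (Hyperbolic, $H>1$.) $\mathcal D\subset\mathbb H^{n+1}=\{(z,y)\in\mathbb R^n\times\mathbb R: y>0\}$ (half-space model, curvature $-1$) is the hypersurface of revolution $\{(e^t\sin\varphi(t)\,\omega,\ e^t\cos\varphi(t)): t\in\mathbb R,\ \omega\in S^{n-1}\}$ with constant mean curvature $H$, where $\varphi:\mathbb R\to(0,\pi/2)$ is smooth and $$\mu=\frac{(\tan\varphi)^{n-1}}{\cos\varphi\,\sqrt{1+\varphi'^2}}-H(\tan\varphi)^n .$$ The mean curvature is taken with respect to the unit normal that gives a round cylinder around the axis positive mean curvature. Let $L=\Delta-V$ be the stability operator of $\mathcal D$, where $\Delta$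 is the non-negative Laplace–Beltrami operator of the induced metric, $V=nc+\|B\|^2$, $B$ is the second fundamental form, and $c=0$ (Euclidean case) or $c=-1$ (hyperbolic case). Let $\mathcal D_+$ be the intersection of $\mathcal D$ with one of the closed half-spaces bounded by a geodesic hyperplane containing the axis of $\mathcal D$. For $\Omega\subset\mathcal D$, let $H^1_0(\Omega)$ be the closure in $H^1(\mathcal D)$ of the smooth functions with compact support in the interior of $\Omega$ relative to $\mathcal D$, and let $Q(u)=\int_{\mathcal D}(|\nabla u|^2-Vu^2)\,dv$ be the quadratic form of $L$. Proposition 4.1. For every $\Omega\subset\mathcal D_+$ the operator $\Delta-V$ is positive in $\Omega$ with respect to Dirichlet boundary conditions: $Q(u)>0$ for every non-zero $u\in H^1_0(\Omega)$, and if $\Omega$ is contained in a compact subset of $\mathcal D$ then its first Dirichlet eigenvalue is positive, that is, there is $\lambda>0$ (which may depend on $\Omega$) with $Q(u)\ge\lambda\int_{\mathcal D} u^2\,dv$ for all $u\in H^1_0(\Omega)$. In particular, the half-unduloid $\mathcal D_+$ is strongly stable: $Q(u)\ge 0$ for every $u\in H^1_0(\Omega)$ and every $\Omega\subset\mathcal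 D_+$ contained in a compact subset of $\mathcal D$, without any volume constraint on $u$. -/

import Mathlib

open MeasureTheory Filter Topology
open scoped ContDiff

noncomputable section

namespace Delaunay

/-! ### The ambient space forms -/

/-- The simply connected space forms of curvature `0` and `-1`. -/
inductive SpaceForm
  | euclidean
  | hyperbolic

/-- The constant sectional curvature. -/
def SpaceForm.curvature : SpaceForm → ℝ
  | .euclidean => 0
  | .hyperbolic => -1

/-- `ℝ × ℝⁿ`, with the coordinate along the axis written first. It carries the points of
`ℝⁿ⁺¹`, or of the half-space model `{(y, z) | 0 < y}` of hyperbolic space, and also their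
tangent vectors. Its own (supremum) norm is used only for its topology. -/
abbrev Amb (n : ℕ) : Type := ℝ × EuclideanSpace ℝ (Fin n)

/-- The Riemannian metric of the space form at the point `p`: the Euclidean metric, or the
half-space metric `(dy² + |dz|²) / y²`. -/
def SpaceForm.metric {n : ℕ} (c : SpaceForm) (p v w : Amb n) : ℝ :=
  match c with
  | .euclidean => v.1 * w.1 + inner ℝ v.2 w.2
  | .hyperbolic => (v.1 * w.1 + inner ℝ v.2 w.2) / p.1 ^ 2

/-- Christoffel symbols of the first kind of the ambient metric, i.e. `⟨∇_a b, d⟩` for constant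
vector fields `a`, `b`, `d`, where `∇` is the Levi-Civita connection. -/
def SpaceForm.christoffel {n : ℕ} (c : SpaceForm) (p a b d : Amb n) : ℝ :=
  (fderiv ℝ (fun q => c.metric q b d) p a + fderiv ℝ (fun q => c.metric q a d) p b
    - fderiv ℝ (fun q => c.metric q a b) p d) / 2

/-! ### Hypersurfaces of revolution -/

/-- A profile curve `t ↦ (axial t, radial t)` in a half-plane bounded by the axis. -/
structure Profile where
  axial : ℝ → ℝ
  radial : ℝ → ℝ

/-- The parameter manifold `ℝ × Sⁿ⁻¹` of a hypersurface of revolution. -/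
abbrev Cyl (n : ℕ) : Type := ℝ × Metric.sphere (0 : EuclideanSpace ℝ (Fin n)) 1

/-- The inclusion `ℝ × Sⁿ⁻¹ ⊆ ℝ × ℝⁿ`. -/
def Cyl.incl {n : ℕ} (p : Cyl n) : Amb n := (p.1, (p.2 : EuclideanSpace ℝ (Fin n)))

/-- The parametrization `(t, ω) ↦ (axial t, radial t • ω)`, written on all of `ℝ × ℝⁿ` so that it
can be differentiated in the directions tangent to `ℝ × Sⁿ⁻¹`. -/
def Profile.param {n : ℕ} (P : Profile) (q : Amb n) : Amb n :=
  (P.axial q.1, P.radial q.1 • q.2)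

/-- The hypersurface of revolution, as a subset of the ambient space. -/
def Profile.surface (n : ℕ) (P : Profile) : Set (Amb n) :=
  Set.range fun p : Cyl n => P.param p.incl

/-- The unit normal along the parametrization that points towards the axis where
`axial` is increasing (the metrics are conformal to the Euclidean one). -/
def unitNormal {n : ℕ} (c : SpaceForm) (P : Profile) (q : Amb n) : Amb n :=
  let ν : Amb n := (deriv P.radial q.1, -(deriv P.axial q.1 • q.2))
  (√(c.metric (P.param q) ν ν))⁻¹ • ν

/-- The first fundamental form (induced metric). -/
def firstForm {n : ℕ} (c : SpaceForm) (P : Profile) (p : Cyl n) (v w : Amb n) : ℝ :=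
  c.metric (P.param p.incl) (fderiv ℝ P.param p.incl v) (fderiv ℝ P.param p.incl w)

/-- The second fundamental form `-⟨∇_v N, w⟩` with respect to `unitNormal`, for `v`, `w` tangent
to `ℝ × Sⁿ⁻¹`. -/
def secondForm {n : ℕ} (c : SpaceForm) (P : Profile) (p : Cyl n) (v w : Amb n) : ℝ :=
  -(c.metric (P.param p.incl)
      (fderiv ℝ (unitNormal c P) p.incl v) (fderiv ℝ P.param p.incl w)
    + c.christoffel (P.param p.incl)
      (fderiv ℝ P.param p.incl v) (unitNormal c P p.incl) (fderiv ℝ P.param p.incl w))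

/-- Indices for a frame of the tangent space of `ℝ × Sⁿ⁻¹` at `p`. -/
abbrev FrameIx {n : ℕ} (p : Cyl n) : Type :=
  Option (Fin (Module.finrank ℝ (ℝ ∙ (p.2 : EuclideanSpace ℝ (Fin n)))ᗮ))

/-- A frame of the tangent space `ℝ × ω^⊥` of `ℝ × Sⁿ⁻¹` at `p = (t, ω)`, orthonormal for the
product metric. -/
def frame {n : ℕ} (p : Cyl n) : FrameIx p → Amb n
  | none => (1, 0)
  | some i => (0, (stdOrthonormalBasis ℝ (ℝ ∙ (p.2 : EuclideanSpace ℝ (Fin n)))ᗮ i :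
      (ℝ ∙ (p.2 : EuclideanSpace ℝ (Fin n)))ᗮ))

/-- The matrix `g_ij` of the induced metric in the frame. -/
def gram {n : ℕ} (c : SpaceForm) (P : Profile) (p : Cyl n) : Matrix (FrameIx p) (FrameIx p) ℝ :=
  Matrix.of fun i j => firstForm c P p (frame p i) (frame p j)

/-- The matrix `h_ij` of the second fundamental form in the frame. -/
def secondMatrix {n : ℕ} (c : SpaceForm) (P : Profile) (p : Cyl n) :
    Matrix (FrameIx p) (FrameIx p) ℝ :=
  Matrix.of fun i j => secondForm c P p (frame p i) (frame p j)

/-- The normalized mean curvature `g^ij h_ij / n`. -/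
def meanCurvature {n : ℕ} (c : SpaceForm) (P : Profile) (p : Cyl n) : ℝ :=
  ((gram c P p)⁻¹ * secondMatrix c P p).trace / n

/-- The squared norm `‖B‖² = g^ij h_jk g^kl h_il` of the second fundamental form. -/
def secondFormNormSq {n : ℕ} (c : SpaceForm) (P : Profile) (p : Cyl n) : ℝ :=
  ((gram c P p)⁻¹ * secondMatrix c P p * (gram c P p)⁻¹ * (secondMatrix c P p).transpose).trace

/-- The potential `V = n c + ‖B‖²` of the stability operator `Δ - V`, where `c` is the ambient
curvature. -/
def potential {n : ℕ} (c : SpaceForm) (P : Profile) (p : Cyl n) : ℝ :=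
  n * c.curvature + secondFormNormSq c P p

/-- The Riemannian volume measure of the induced metric, carried by `ℝ × Sⁿ⁻¹`: its density with
respect to the product of Lebesgue measure and the surface measure of the sphere is the square
root of the determinant of the induced metric in a frame orthonormal for the product metric. -/
def area (n : ℕ) (c : SpaceForm) (P : Profile) : Measure (Cyl n) :=
  ((volume : Measure ℝ).prod
    (volume : Measure (EuclideanSpace ℝ (Fin n))).toSphere).withDensity
      fun p => ENNReal.ofReal (√(gram c P p).det)

/-- The squared norm `g^ij η_i η_j` of a covector. Only the values of `η` on tangent vectors of
`ℝ × Sⁿ⁻¹` are used. -/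
def covectorNormSq {n : ℕ} (c : SpaceForm) (P : Profile) (p : Cyl n) (η : Amb n →L[ℝ] ℝ) : ℝ :=
  (fun i => η (frame p i)) ⬝ᵥ ((gram c P p)⁻¹.mulVec fun i => η (frame p i))

/-! ### Dirichlet conditions and the stability form

Functions on the embedded hypersurface are identified with functions on `ℝ × Sⁿ⁻¹` through the
parametrization. The smooth functions on `ℝ × Sⁿ⁻¹` are the restrictions of the smooth functions
on `ℝ × ℝⁿ`. -/

/-- The restriction of `U` to `ℝ × Sⁿ⁻¹` is a smooth function with compact support in the interior
of `Ω` relative to the hypersurface. -/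
def IsTest {n : ℕ} (P : Profile) (Ω : Set (Amb n)) (U : Amb n → ℝ) : Prop :=
  ContDiff ℝ ∞ U ∧ HasCompactSupport (fun p : Cyl n => U p.incl) ∧
    tsupport (fun p : Cyl n => U p.incl) ⊆ interior {p : Cyl n | P.param p.incl ∈ Ω}

/-- `u` belongs to the Sobolev space `H¹₀(Ω)`, the closure in `H¹` of the smooth functions with
compact support in the interior of `Ω`, and `η` is its weak differential. -/
def MemH10 {n : ℕ} (c : SpaceForm) (P : Profile) (Ω : Set (Amb n))
    (u : Cyl n → ℝ) (η : Cyl n → Amb n →L[ℝ] ℝ) : Prop :=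
  MemLp u 2 (area n c P) ∧ AEStronglyMeasurable η (area n c P) ∧
  ∃ U : ℕ → Amb n → ℝ, (∀ k, IsTest P Ω (U k)) ∧
    Tendsto (fun k => ∫⁻ p, ENNReal.ofReal ((U k p.incl - u p) ^ 2) ∂(area n c P)) atTop (𝓝 0) ∧
    Tendsto (fun k => ∫⁻ p, ENNReal.ofReal
      (covectorNormSq c P p (fderiv ℝ (U k) p.incl - η p)) ∂(area n c P)) atTop (𝓝 0)

/-- The quadratic form `∫ (|du|² - V u²)` of the stability operator `Δ - V` (with `Δ` the
non-negative Laplace–Beltrami operator), for a function `u` with differential `η`. -/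
def stabilityForm {n : ℕ} (c : SpaceForm) (P : Profile)
    (u : Cyl n → ℝ) (η : Cyl n → Amb n →L[ℝ] ℝ) : ℝ :=
  ∫ p, (covectorNormSq c P p (η p) - potential c P p * u p ^ 2) ∂(area n c P)

/-- `Ω` is contained in a compact subset of the hypersurface. -/
def RelativelyCompact {n : ℕ} (P : Profile) (Ω : Set (Amb n)) : Prop :=
  ∃ K : Set (Amb n), IsCompact K ∧ K ⊆ P.surface n ∧ Ω ⊆ K

/-- The stability operator is positive in `Ω` with respect to Dirichlet boundary conditions: its
quadratic form is positive definite on `H¹₀(Ω)` and, when `Ω` is relatively compact, its first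
Dirichlet eigenvalue is positive. -/
def DirichletPositive {n : ℕ} (c : SpaceForm) (P : Profile) (Ω : Set (Amb n)) : Prop :=
  (∀ u η, MemH10 c P Ω u η → ¬ u =ᵐ[area n c P] 0 → 0 < stabilityForm c P u η) ∧
  (RelativelyCompact P Ω → ∃ l : ℝ, 0 < l ∧
    ∀ u η, MemH10 c P Ω u η → l * ∫ p, u p ^ 2 ∂(area n c P) ≤ stabilityForm c P u η)

/-- Strong stability of a piece `W` of the hypersurface: the stability form is non-negative, without
any volume constraint, on every relatively compact piece with Dirichlet conditions (so that the
Dirichlet index is `0`). -/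
def StronglyStable {n : ℕ} (c : SpaceForm) (P : Profile) (W : Set (Amb n)) : Prop :=
  ∀ Ω ⊆ W, RelativelyCompact P Ω → ∀ u η, MemH10 c P Ω u η → 0 ≤ stabilityForm c P u η

/-! ### Delaunay unduloids -/

/-- The profile of the hypersurface `(x, ω) ↦ (x, f x • ω)` of Euclidean space. -/
def euclideanProfile (f : ℝ → ℝ) : Profile := ⟨fun x => x, f⟩

/-- The profile of the hypersurface of the half-space whose point at time `t` makes the angle
`φ t` with the axis, at Euclidean distance `exp t` from the origin. -/
def hyperbolicProfile (φ : ℝ → ℝ) : Profile :=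
  ⟨fun t => Real.exp t * Real.cos (φ t), fun t => Real.exp t * Real.sin (φ t)⟩

/-- The profile curve of an unduloid with weight parameter `μ` and mean curvature `H`: `H = 1` in
Euclidean space, `H > 1` in hyperbolic space. -/
def IsUnduloidProfile (n : ℕ) (H μ : ℝ) (P : Profile) : SpaceForm → Prop
  | .euclidean => H = 1 ∧ ∃ f : ℝ → ℝ, ContDiff ℝ ∞ f ∧ (∀ x, 0 < f x) ∧ P = euclideanProfile f ∧
      ∀ x, μ = f x ^ (n - 1) / √(1 + deriv f x ^ 2) - f x ^ n
  | .hyperbolic => 1 < H ∧ ∃ φ : ℝ → ℝ, ContDiff ℝ ∞ φ ∧ (∀ t, 0 < φ t ∧ φ t < Real.pi / 2) ∧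
      P = hyperbolicProfile φ ∧
      ∀ t, μ = Real.tan (φ t) ^ (n - 1) / (Real.cos (φ t) * √(1 + deriv φ t ^ 2))
        - H * Real.tan (φ t) ^ n

/-- A Delaunay unduloid of dimension `n` with constant mean curvature `H` and weight parameter
`μ > 0`. (The condition on the mean curvature matters only for constant solutions of the equation
of the profile curve, for which it selects the cylinder of mean curvature `H`.) -/
def IsDelaunayUnduloid (n : ℕ) (c : SpaceForm) (H μ : ℝ) (P : Profile) : Prop :=
  0 < μ ∧ IsUnduloidProfile n H μ P c ∧ ∀ p : Cyl n, meanCurvature c P p = H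

/-- A closed half-space bounded by the geodesic hyperplane that contains the axis and has
normal direction `θ`. -/
def halfSpace {n : ℕ} (θ : EuclideanSpace ℝ (Fin n)) : Set (Amb n) :=
  {p | 0 ≤ inner ℝ θ p.2}

end Delaunay

end

/-! Translations orthogonal to the axis are ambient isometries (in the half-space model, the
horizontal translations). The normal component of such a Killing field along `θ` is, up to sign, the
Jacobi field `⟨θ, ω⟩ ψ t`. Here `ψ = 1 / √(1 + f'²)` in the Euclidean case, and `ψ = e^{-t} (1 - φ'
tan φ) / √(1 + φ'²)` in the hyperbolic case. Since `μ > 0`, `ψ` is positive, so the Jacobi field is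
positive on the open half-unduloid, and a positive solution of `(Δ - V) w = 0` forces the quadratic
form to be non-negative there.

Instead of dividing by the whole Jacobi field at once, the proof separates variables. Write the
metric as `E dt² + G dω²` with area density `D`. On each sphere, `⟨θ, ω⟩` is the first Dirichlet
eigenfunction of the hemisphere, with eigenvalue `n - 1`. Picone's inequality `|∇u|² ≥ ⟨∇(u² / ⟨θ,
ω⟩), θ⟩` (`picone_le`), combined with the divergence theorem on the sphere
(`integral_sphere_fderiv`), bounds the spherical energy below by `(n - 1) ∫ u²` (`integral_picone`).
In the axial direction there remains `p u'² + q u²` with `p = D / E` and `q = ((n - 1) / G - V) D`.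
The Jacobi equation says `(p ψ')' = q ψ`, so up to a total derivative this is `p ψ² (v')²` with `v =
u / ψ`.

Strict positivity comes from a Hardy-type estimate for that remainder. Put `B = 1 / (1 + e^{2t})`.
The growth bounds in `IsJacobiFactor` say that `B` is at most a constant times `p ψ²` and `D ψ²`.
Expanding `B (v' - ε v)² ≥ 0` and integrating by parts gives `Q(u) ≥ ∫ (ε ρ - ε²) u²`, where `ρ > 0`
because `B` is strictly decreasing (`axial_picone`, `exists_weight`). This passes from test
functions to `H¹₀` by `L²` continuity (`le_stabilityForm`), since `V` is bounded. A small `ε`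
depending on `u` yields `Q(u) > 0`. On a relatively compact piece `ρ` has a positive lower bound,
and a uniform `ε` yields a spectral gap.

The rest verifies `IsJacobiFactor`: the equation defining `μ` gives the spherical principal
curvature, the mean curvature gives the axial one, and together they give the Jacobi equation and
the uniform bounds. -/

noncomputable section

namespace Delaunay

/-! ### Conformal description of the ambient metrics -/

/-- The ambient metric is the Euclidean one divided by the square of this function of the axial
coordinate. -/
def SpaceForm.scale : SpaceForm → ℝ → ℝ
  | .euclidean => fun _ => 1
  | .hyperbolic => fun y => y

/-- The derivative of `SpaceForm.scale`. -/
def SpaceForm.scaleDeriv : SpaceForm → ℝ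
  | .euclidean => 0
  | .hyperbolic => 1

/-- The Euclidean inner product on `ℝ × ℝⁿ`. -/
def dot {n : ℕ} (v w : Amb n) : ℝ := v.1 * w.1 + inner ℝ v.2 w.2

lemma SpaceForm.metric_eq {n : ℕ} (c : SpaceForm) (p v w : Amb n) :
    c.metric p v w = dot v w / c.scale p.1 ^ 2 := by
  cases c <;> simp [SpaceForm.metric, SpaceForm.scale, dot]

lemma SpaceForm.hasDerivAt_scale (c : SpaceForm) (y : ℝ) :
    HasDerivAt c.scale c.scaleDeriv y := by
  cases c
  · exact hasDerivAt_const y (1 : ℝ)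
  · exact hasDerivAt_id y

lemma SpaceForm.differentiable_scale (c : SpaceForm) : Differentiable ℝ c.scale :=
  fun y => (c.hasDerivAt_scale y).differentiableAt

lemma SpaceForm.continuous_scale (c : SpaceForm) : Continuous c.scale :=
  c.differentiable_scale.continuous

lemma SpaceForm.fderiv_metric {n : ℕ} (c : SpaceForm) (p v w a : Amb n) (hp : c.scale p.1 ≠ 0) :
    fderiv ℝ (fun q => c.metric q v w) p a
      = -2 * c.scaleDeriv * dot v w * a.1 / c.scale p.1 ^ 3 := by
  have h1 : HasFDerivAt (fun q : Amb n => c.scale q.1)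
      (c.scaleDeriv • ContinuousLinearMap.fst ℝ ℝ (EuclideanSpace ℝ (Fin n))) p :=
    (c.hasDerivAt_scale p.1).comp_hasFDerivAt p hasFDerivAt_fst
  have h2 : HasDerivAt (fun y : ℝ => dot v w / y ^ 2)
      (-2 * dot v w / c.scale p.1 ^ 3) (c.scale p.1) := by
    have := (hasDerivAt_const (c.scale p.1) (dot v w)).fun_div
      (hasDerivAt_pow 2 (c.scale p.1)) (pow_ne_zero 2 hp)
    refine this.congr_deriv ?_
    field_simp
    simp
    ring
  have h3 := h2.comp_hasFDerivAt p h1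
  have h4 : (fun q => c.metric q v w) = fun q : Amb n => dot v w / c.scale q.1 ^ 2 := by
    funext q; exact c.metric_eq q v w
  rw [h4, show (fun q : Amb n => dot v w / c.scale q.1 ^ 2)
    = (fun y : ℝ => dot v w / y ^ 2) ∘ fun q : Amb n => c.scale q.1 from rfl, h3.fderiv]
  simp
  ring

lemma SpaceForm.christoffel_eq {n : ℕ} (c : SpaceForm) (p a b d : Amb n)
    (hp : c.scale p.1 ≠ 0) :
    c.christoffel p a b d
      = -c.scaleDeriv * (dot b d * a.1 + dot a d * b.1 - dot a b * d.1) / c.scale p.1 ^ 3 := by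
  simp only [SpaceForm.christoffel, c.fderiv_metric _ _ _ _ hp]
  ring

/-! ### The fundamental forms of a hypersurface of revolution -/

/-- A smooth regular profile off the axis, in the region where the ambient metric is defined. -/
structure Profile.Regular (P : Profile) (c : SpaceForm) : Prop where
  axial : ContDiff ℝ ∞ P.axial
  radial : ContDiff ℝ ∞ P.radial
  radial_pos : ∀ t, 0 < P.radial t
  scale_pos : ∀ t, 0 < c.scale (P.axial t)
  speed_pos : ∀ t, 0 < deriv P.axial t ^ 2 + deriv P.radial t ^ 2

/-- The Euclidean speed of the profile curve. -/
def Profile.speed (P : Profile) (t : ℝ) : ℝ := √(deriv P.axial t ^ 2 + deriv P.radial t ^ 2)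

/-- The coefficient of `dt²` in the induced metric. -/
def Profile.coeffAxial (P : Profile) (c : SpaceForm) (t : ℝ) : ℝ :=
  (deriv P.axial t ^ 2 + deriv P.radial t ^ 2) / c.scale (P.axial t) ^ 2

/-- The coefficient of the round metric of the sphere in the induced metric. -/
def Profile.coeffSphere (P : Profile) (c : SpaceForm) (t : ℝ) : ℝ :=
  P.radial t ^ 2 / c.scale (P.axial t) ^ 2

/-- The principal curvature of the profile curve. -/
def Profile.curvAxial (P : Profile) (c : SpaceForm) (t : ℝ) : ℝ :=
  c.scale (P.axial t) * (deriv (deriv P.axial) t * deriv P.radial t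
    - deriv (deriv P.radial) t * deriv P.axial t) / P.speed t ^ 3
    + c.scaleDeriv * deriv P.radial t / P.speed t

/-- The principal curvature in the directions of the sphere. -/
def Profile.curvSphere (P : Profile) (c : SpaceForm) (t : ℝ) : ℝ :=
  c.scale (P.axial t) * deriv P.axial t / (P.speed t * P.radial t)
    + c.scaleDeriv * deriv P.radial t / P.speed t

section Frame
variable {n : ℕ}

lemma inner_incl_self (p : Cyl n) : inner ℝ p.incl.2 p.incl.2 = (1 : ℝ) := by
  have : ‖p.incl.2‖ = 1 := by simp [Cyl.incl]
  rw [real_inner_self_eq_norm_sq, this]; norm_num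

lemma inner_frame (p : Cyl n) (i) : inner ℝ p.incl.2 (frame p (some i)).2 = (0 : ℝ) := by
  have := (stdOrthonormalBasis ℝ (ℝ ∙ (p.2 : EuclideanSpace ℝ (Fin n)))ᗮ i).2
  rw [Submodule.mem_orthogonal_singleton_iff_inner_right] at this
  exact this

lemma inner_frame_frame (p : Cyl n) (i j) :
    inner ℝ (frame p (some i)).2 (frame p (some j)).2 = (if i = j then 1 else 0 : ℝ) := by
  have := orthonormal_iff_ite.1
    (stdOrthonormalBasis ℝ (ℝ ∙ (p.2 : EuclideanSpace ℝ (Fin n)))ᗮ).orthonormal i j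
  simpa [frame] using this

lemma finrank_orthogonal_sphere (p : Cyl n) :
    Module.finrank ℝ (ℝ ∙ (p.2 : EuclideanSpace ℝ (Fin n)))ᗮ = n - 1 := by
  have h0 : (p.2 : EuclideanSpace ℝ (Fin n)) ≠ 0 := by
    intro h
    have := p.2.2
    rw [h] at this; simp at this
  have h1 := Submodule.finrank_add_finrank_orthogonal (ℝ ∙ (p.2 : EuclideanSpace ℝ (Fin n)))
  rw [finrank_span_singleton h0, finrank_euclideanSpace_fin] at h1
  omega

end Frame

section Forms
variable {n : ℕ} {c : SpaceForm} {P : Profile}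

lemma Profile.Regular.differentiable_axial (h : P.Regular c) : Differentiable ℝ P.axial :=
  h.axial.differentiable (by simp)
lemma Profile.Regular.differentiable_radial (h : P.Regular c) : Differentiable ℝ P.radial :=
  h.radial.differentiable (by simp)
lemma Profile.Regular.differentiable_deriv_axial (h : P.Regular c) :
    Differentiable ℝ (deriv P.axial) :=
  ((contDiff_infty_iff_deriv.1 h.axial).2).differentiable (by simp)
lemma Profile.Regular.differentiable_deriv_radial (h : P.Regular c) :
    Differentiable ℝ (deriv P.radial) :=
  ((contDiff_infty_iff_deriv.1 h.radial).2).differentiable (by simp)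

lemma Profile.Regular.fderiv_param (h : P.Regular c) (q v : Amb n) :
    fderiv ℝ P.param q v
      = (deriv P.axial q.1 * v.1, (deriv P.radial q.1 * v.1) • q.2 + P.radial q.1 • v.2) := by
  have ha : HasFDerivAt (fun q : Amb n => P.axial q.1)
      (deriv P.axial q.1 • ContinuousLinearMap.fst ℝ ℝ (EuclideanSpace ℝ (Fin n))) q :=
    (h.differentiable_axial q.1).hasDerivAt.comp_hasFDerivAt q hasFDerivAt_fst
  have hr : HasFDerivAt (fun q : Amb n => P.radial q.1)
      (deriv P.radial q.1 • ContinuousLinearMap.fst ℝ ℝ (EuclideanSpace ℝ (Fin n))) q :=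
    (h.differentiable_radial q.1).hasDerivAt.comp_hasFDerivAt q hasFDerivAt_fst
  have := ha.prodMk (hr.smul (hasFDerivAt_snd (𝕜 := ℝ) (p := q)))
  rw [show (P.param : Amb n → Amb n) = fun q => (P.axial q.1, P.radial q.1 • q.2) from rfl]
  erw [this.fderiv]
  simp [add_comm]

/-- The normal before normalization. -/
def conormal (P : Profile) (q : Amb n) : Amb n :=
  (deriv P.radial q.1, -(deriv P.axial q.1 • q.2))

lemma Profile.Regular.hasFDerivAt_conormal (h : P.Regular c) (q : Amb n) :
    ∃ A : Amb n →L[ℝ] Amb n, HasFDerivAt (conormal P) A q ∧ ∀ v, A v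
      = (deriv (deriv P.radial) q.1 * v.1,
        -((deriv (deriv P.axial) q.1 * v.1) • q.2 + deriv P.axial q.1 • v.2)) := by
  have ha : HasFDerivAt (fun q : Amb n => deriv P.axial q.1)
      (deriv (deriv P.axial) q.1 • ContinuousLinearMap.fst ℝ ℝ (EuclideanSpace ℝ (Fin n))) q :=
    (h.differentiable_deriv_axial q.1).hasDerivAt.comp_hasFDerivAt q hasFDerivAt_fst
  have hr : HasFDerivAt (fun q : Amb n => deriv P.radial q.1)
      (deriv (deriv P.radial) q.1 • ContinuousLinearMap.fst ℝ ℝ (EuclideanSpace ℝ (Fin n))) q :=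
    (h.differentiable_deriv_radial q.1).hasDerivAt.comp_hasFDerivAt q hasFDerivAt_fst
  have := hr.prodMk (ha.smul (hasFDerivAt_snd (𝕜 := ℝ) (p := q))).neg
  refine ⟨_, this, fun v => ?_⟩
  simp [add_comm]

/-- Differentiating the normalizing factor only adds a multiple of the conormal, which is orthogonal
to the hypersurface and so contributes nothing to the second fundamental form. The coefficient `k`
can therefore stay unspecified. -/
lemma Profile.Regular.fderiv_unitNormal (h : P.Regular c) (p : Cyl n) (v : Amb n) :
    ∃ k : ℝ, fderiv ℝ (unitNormal c P) p.incl v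
      = k • conormal P p.incl + (c.scale (P.axial p.1) / P.speed p.1) •
      ((deriv (deriv P.radial) p.1 * v.1,
        -((deriv (deriv P.axial) p.1 * v.1) • p.incl.2 + deriv P.axial p.1 • v.2)) : Amb n) := by
  obtain ⟨A, hA, hAv⟩ := h.hasFDerivAt_conormal p.incl
  have hdd : ∀ q : Amb n, c.metric (P.param q) (conormal P q) (conormal P q)
      = (deriv P.radial q.1 ^ 2 + deriv P.axial q.1 ^ 2 * inner ℝ q.2 q.2)
        / c.scale (P.axial q.1) ^ 2 := by
    intro q
    rw [c.metric_eq]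
    simp only [dot, conormal, Profile.param, inner_neg_left, inner_neg_right, inner_smul_left,
      inner_smul_right]
    simp
    ring
  have hpos : 0 < (deriv P.radial p.1 ^ 2 + deriv P.axial p.1 ^ 2 * inner ℝ p.incl.2 p.incl.2)
        / c.scale (P.axial p.1) ^ 2 := by
    rw [inner_incl_self]
    have h1 := h.speed_pos p.1
    have h2 := h.scale_pos p.1
    have : 0 < deriv P.radial p.1 ^ 2 + deriv P.axial p.1 ^ 2 * 1 := by linarith
    positivity
  have hg : DifferentiableAt ℝ (fun q : Amb n =>
      (√((deriv P.radial q.1 ^ 2 + deriv P.axial q.1 ^ 2 * inner ℝ q.2 q.2)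
        / c.scale (P.axial q.1) ^ 2))⁻¹) p.incl := by
    have h1 : DifferentiableAt ℝ (fun q : Amb n => deriv P.radial q.1) p.incl :=
      (h.differentiable_deriv_radial p.incl.1).comp p.incl differentiableAt_fst
    have h2 : DifferentiableAt ℝ (fun q : Amb n => deriv P.axial q.1) p.incl :=
      (h.differentiable_deriv_axial p.incl.1).comp p.incl differentiableAt_fst
    have h3 : DifferentiableAt ℝ (fun q : Amb n => c.scale (P.axial q.1)) p.incl :=
      (c.differentiable_scale _).comp p.incl
        ((h.differentiable_axial p.incl.1).comp p.incl differentiableAt_fst)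
    have h4 : DifferentiableAt ℝ (fun q : Amb n => (inner ℝ q.2 q.2 : ℝ)) p.incl :=
      differentiableAt_snd.inner ℝ differentiableAt_snd
    refine DifferentiableAt.fun_inv (DifferentiableAt.sqrt ?_ hpos.ne') (Real.sqrt_pos.2 hpos).ne'
    have h5 := ((h1.pow 2).add ((h2.pow 2).mul h4)).mul
      ((h3.pow 2).inv (pow_ne_zero 2 (h.scale_pos p.1).ne'))
    exact h5
  have hun : (unitNormal c P : Amb n → Amb n) = fun q : Amb n =>
      (√((deriv P.radial q.1 ^ 2 + deriv P.axial q.1 ^ 2 * inner ℝ q.2 q.2)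
        / c.scale (P.axial q.1) ^ 2))⁻¹ • conormal P q := by
    funext q
    rw [← hdd]; rfl
  refine ⟨fderiv ℝ (fun q : Amb n =>
      (√((deriv P.radial q.1 ^ 2 + deriv P.axial q.1 ^ 2 * inner ℝ q.2 q.2)
        / c.scale (P.axial q.1) ^ 2))⁻¹) p.incl v, ?_⟩
  have hval : (√((deriv P.radial p.1 ^ 2 + deriv P.axial p.1 ^ 2 * inner ℝ p.incl.2 p.incl.2)
        / c.scale (P.axial p.1) ^ 2))⁻¹ = c.scale (P.axial p.1) / P.speed p.1 := by
    rw [inner_incl_self, mul_one, Real.sqrt_div' _ (by positivity),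
      Real.sqrt_sq (h.scale_pos p.1).le, inv_div, add_comm]
    rfl
  rw [hun, fderiv_fun_smul hg hA.differentiableAt, hA.fderiv, ← hval]
  simp only [add_apply, smul_apply,
    ContinuousLinearMap.smulRight_apply, hAv]
  rw [add_comm]
  rfl

lemma Profile.Regular.unitNormal_incl (h : P.Regular c) (p : Cyl n) :
    unitNormal c P p.incl = (c.scale (P.axial p.1) / P.speed p.1) • conormal P p.incl := by
  have : (√(c.metric (P.param p.incl) (conormal P p.incl) (conormal P p.incl)))⁻¹
      = c.scale (P.axial p.1) / P.speed p.1 := by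
    rw [c.metric_eq]
    have : dot (conormal P p.incl) (conormal P p.incl)
        = deriv P.axial p.1 ^ 2 + deriv P.radial p.1 ^ 2 := by
      simp only [dot, conormal, inner_neg_left, inner_neg_right, inner_smul_left,
        inner_smul_right, inner_incl_self]
      simp [Cyl.incl]
      ring
    rw [this, Real.sqrt_div' _ (by positivity)]
    change (_ / √(c.scale (P.axial p.1) ^ 2))⁻¹ = _
    rw [Real.sqrt_sq (h.scale_pos p.1).le, inv_div]
    rfl
  rw [← this]; rfl

lemma Profile.speed_sq (P : Profile) (t : ℝ) :
    P.speed t ^ 2 = deriv P.axial t ^ 2 + deriv P.radial t ^ 2 :=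
  Real.sq_sqrt (by positivity)

lemma Profile.Regular.speed_pos' (h : P.Regular c) (t : ℝ) : 0 < P.speed t :=
  Real.sqrt_pos.2 (h.speed_pos t)

lemma Profile.Regular.gram_eq (h : P.Regular c) (p : Cyl n) :
    gram c P p = Matrix.diagonal fun i : FrameIx p =>
      i.elim (P.coeffAxial c p.1) fun _ => P.coeffSphere c p.1 := by
  ext i j
  have h1 := inner_incl_self p
  have h2 := fun i => inner_frame p i
  have h3 := fun i => (real_inner_comm _ _).trans (inner_frame p i)
  have h4 := fun i j => inner_frame_frame p i j
  have h5 : p.incl.1 = p.1 := rfl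
  have f1 : ∀ i, (frame p (some i)).1 = 0 := fun _ => rfl
  have f2 : frame p none = (1, 0) := rfl
  rcases i with _ | i <;> rcases j with _ | j <;>
    simp only [gram, Matrix.of_apply, firstForm, c.metric_eq, h.fderiv_param, dot,
      inner_add_left, inner_add_right, inner_smul_left, inner_smul_right, h1, h2, h3, h4, h5, f1,
      f2, Matrix.diagonal_apply, Profile.param, Option.elim, Profile.coeffAxial,
      Profile.coeffSphere, inner_zero_left, inner_zero_right]
  · simp; ring
  · simp
  · simp
  · by_cases hij : i = j <;> simp [hij]
    ring

lemma Profile.Regular.secondMatrix_eq (h : P.Regular c) (p : Cyl n) :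
    secondMatrix c P p = Matrix.diagonal fun i : FrameIx p =>
      i.elim (P.curvAxial c p.1 * P.coeffAxial c p.1)
        fun _ => P.curvSphere c p.1 * P.coeffSphere c p.1 := by
  ext i j
  have h1 := inner_incl_self p
  have h2 := fun i => inner_frame p i
  have h3 := fun i => (real_inner_comm _ _).trans (inner_frame p i)
  have h4 := fun i j => inner_frame_frame p i j
  have h5 : p.incl.1 = p.1 := rfl
  have f1 : ∀ i, (frame p (some i)).1 = 0 := fun _ => rfl
  have f2 : frame p none = (1, 0) := rfl
  have hs := h.speed_pos' p.1
  have hsq := P.speed_sq p.1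
  have hL := h.scale_pos p.1
  have hr := h.radial_pos p.1
  have hL' : c.scale (P.param p.incl).1 ≠ 0 := hL.ne'
  have hLe : c.scale (P.param p.incl).1 = c.scale (P.axial p.1) := rfl
  obtain ⟨k, hk⟩ := h.fderiv_unitNormal p (frame p i)
  simp only [secondMatrix, Matrix.of_apply, secondForm]
  rw [c.christoffel_eq _ _ _ _ hL', c.metric_eq, hk, h.unitNormal_incl, hLe]
  simp only [Profile.curvAxial, Profile.curvSphere, Profile.coeffAxial, ← hsq,
    Profile.coeffSphere, Matrix.diagonal_apply]
  generalize hσ : P.speed p.1 = σ at *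
  generalize c.scale (P.axial p.1) = L at *
  rcases i with _ | i <;> rcases j with _ | j <;>
    simp only [h.fderiv_param, dot, conormal, Prod.smul_fst, Prod.smul_snd, Prod.fst_add,
      Prod.snd_add, inner_neg_left, inner_neg_right,
      inner_add_left, inner_add_right, inner_smul_left, inner_smul_right, h1, h2, h3, h4, h5, f1,
      f2, Option.elim, inner_zero_left, inner_zero_right, smul_eq_mul]
  · simp
    field_simp
    linear_combination (-c.scaleDeriv * deriv P.radial p.1) * hsq
  · simp
  · simp; left; ring
  · by_cases hij : i = j <;> simp [hij]
    field_simp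
    ring

/-- The projection onto the tangent space of the sphere at `w`. -/
def tang (w v : EuclideanSpace ℝ (Fin n)) : EuclideanSpace ℝ (Fin n) :=
  v - inner ℝ w v • w

/-- Both sides are the squared norm of the tangential projection of the vector dual to `η`. The
right side replaces a frame chosen separately at each point by vectors depending continuously on
`p`, as continuity and measurability arguments require. -/
lemma sum_frame_sq (p : Cyl n) (η : Amb n →L[ℝ] ℝ) :
    ∑ i, η (frame p (some i)) ^ 2
      = ∑ j, η (0, tang p.incl.2 (EuclideanSpace.basisFun (Fin n) ℝ j)) ^ 2 := by
  set a := (InnerProductSpace.toDual ℝ (EuclideanSpace ℝ (Fin n))).symm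
    (η.comp (ContinuousLinearMap.inr ℝ ℝ (EuclideanSpace ℝ (Fin n)))) with ha
  have hη : ∀ v, η (0, v) = inner ℝ a v := by
    intro v
    rw [ha, InnerProductSpace.toDual_symm_apply]
    simp
  have h1 := inner_incl_self p
  have hmem : tang p.incl.2 a ∈ (ℝ ∙ (p.2 : EuclideanSpace ℝ (Fin n)))ᗮ := by
    rw [Submodule.mem_orthogonal_singleton_iff_inner_right]
    change inner ℝ p.incl.2 (a - inner ℝ p.incl.2 a • p.incl.2) = 0
    rw [inner_sub_right, inner_smul_right, h1]
    ring
  have h2 : ∀ v, inner ℝ a (tang p.incl.2 v) = inner ℝ v (tang p.incl.2 a) := by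
    intro v
    simp only [tang, inner_sub_right, inner_smul_right]
    rw [real_inner_comm v a, real_inner_comm v p.incl.2, real_inner_comm a p.incl.2]
    ring
  have h3 : ∀ i, η (frame p (some i)) = inner ℝ
      (stdOrthonormalBasis ℝ (ℝ ∙ (p.2 : EuclideanSpace ℝ (Fin n)))ᗮ i) ⟨_, hmem⟩ := by
    intro i
    have h5 := inner_frame p i
    rw [show frame p (some i) = (0, (frame p (some i)).2) from rfl, hη]
    change _ = inner ℝ (frame p (some i)).2 (a - inner ℝ p.incl.2 a • p.incl.2)
    rw [inner_sub_right, inner_smul_right, real_inner_comm p.incl.2, h5, real_inner_comm a]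
    ring
  simp only [h3, hη, h2]
  have h6 := (stdOrthonormalBasis ℝ (ℝ ∙ (p.2 : EuclideanSpace ℝ (Fin n)))ᗮ).sum_sq_norm_inner_right
    ⟨_, hmem⟩
  have h7 := (EuclideanSpace.basisFun (Fin n) ℝ).sum_sq_norm_inner_right (tang p.incl.2 a)
  simp only [Real.norm_eq_abs, sq_abs] at h6 h7
  rw [h6, h7]
  rfl

lemma Profile.Regular.coeffAxial_pos (h : P.Regular c) (t : ℝ) : 0 < P.coeffAxial c t :=
  div_pos (h.speed_pos t) (pow_pos (h.scale_pos t) 2)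

lemma Profile.Regular.coeffSphere_pos (h : P.Regular c) (t : ℝ) : 0 < P.coeffSphere c t :=
  div_pos (pow_pos (h.radial_pos t) 2) (pow_pos (h.scale_pos t) 2)

lemma Profile.Regular.gram_inv (h : P.Regular c) (p : Cyl n) :
    (gram c P p)⁻¹ = Matrix.diagonal fun i : FrameIx p =>
      i.elim (P.coeffAxial c p.1)⁻¹ fun _ => (P.coeffSphere c p.1)⁻¹ := by
  refine Matrix.inv_eq_right_inv ?_
  rw [h.gram_eq, Matrix.diagonal_mul_diagonal, ← Matrix.diagonal_one]
  congr 1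
  funext i
  rcases i with _ | i
  · exact mul_inv_cancel₀ (h.coeffAxial_pos _).ne'
  · exact mul_inv_cancel₀ (h.coeffSphere_pos _).ne'

lemma Profile.Regular.det_gram (h : P.Regular c) (p : Cyl n) :
    (gram c P p).det = P.coeffAxial c p.1 * P.coeffSphere c p.1 ^ (n - 1) := by
  rw [h.gram_eq, Matrix.det_diagonal, Fintype.prod_option]
  simp [finrank_orthogonal_sphere]

lemma Profile.Regular.covectorNormSq_eq (h : P.Regular c) (p : Cyl n) (η : Amb n →L[ℝ] ℝ) :
    covectorNormSq c P p η = η (1, 0) ^ 2 / P.coeffAxial c p.1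
      + (∑ j, η (0, tang p.incl.2 (EuclideanSpace.basisFun (Fin n) ℝ j)) ^ 2)
        / P.coeffSphere c p.1 := by
  rw [← sum_frame_sq, covectorNormSq, h.gram_inv]
  simp only [dotProduct, Matrix.mulVec_diagonal, Fintype.sum_option, Option.elim, Finset.sum_div]
  congr 1
  · change η (1, 0) * (_ * η (1, 0)) = _
    ring
  · refine Finset.sum_congr rfl fun i _ => ?_
    ring

lemma Profile.Regular.meanCurvature_eq (h : P.Regular c) (hn : 1 ≤ n) (p : Cyl n) :
    meanCurvature c P p = (P.curvAxial c p.1 + (n - 1) * P.curvSphere c p.1) / n := by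
  have h1 := (h.coeffAxial_pos p.1).ne'
  have h2 := (h.coeffSphere_pos p.1).ne'
  rw [meanCurvature, h.gram_inv, h.secondMatrix_eq, Matrix.diagonal_mul_diagonal,
    Matrix.trace_diagonal, Fintype.sum_option]
  simp only [Option.elim, Finset.sum_const, Finset.card_univ, Fintype.card_fin,
    finrank_orthogonal_sphere, nsmul_eq_mul, Nat.cast_sub hn]
  field_simp
  simp
  ring

lemma Profile.Regular.potential_eq (h : P.Regular c) (hn : 1 ≤ n) (p : Cyl n) :
    potential c P p = n * c.curvature + P.curvAxial c p.1 ^ 2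
      + (n - 1) * P.curvSphere c p.1 ^ 2 := by
  have h1 := (h.coeffAxial_pos p.1).ne'
  have h2 := (h.coeffSphere_pos p.1).ne'
  rw [potential, secondFormNormSq, h.gram_inv, h.secondMatrix_eq, Matrix.diagonal_transpose]
  simp only [Matrix.diagonal_mul_diagonal,
    Matrix.trace_diagonal, Fintype.sum_option]
  simp only [Option.elim, Finset.sum_const, Finset.card_univ, Fintype.card_fin,
    finrank_orthogonal_sphere, nsmul_eq_mul, Nat.cast_sub hn]
  field_simp
  simp
  ring

end Forms

/-- The density of the area with respect to the product measure on `ℝ × Sⁿ⁻¹`. -/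
def Profile.density (P : Profile) (n : ℕ) (c : SpaceForm) (t : ℝ) : ℝ :=
  √(P.coeffAxial c t * P.coeffSphere c t ^ (n - 1))

/-- The function `⟨θ, ω⟩ ψ t` is a Jacobi field, with `ψ` positive and not too small at `-∞`;
the potential is the bounded function `V`. -/
structure IsJacobiFactor (n : ℕ) (c : SpaceForm) (P : Profile) (V ψ ψ' : ℝ → ℝ) : Prop where
  regular : P.Regular c
  potential : ∀ p : Cyl n, potential c P p = V p.1
  continuous_potential : Continuous V
  bounded : ∃ C, ∀ t, |V t| ≤ C
  pos : ∀ t, 0 < ψ t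
  hasDerivAt : ∀ t, HasDerivAt ψ (ψ' t) t
  continuous_deriv : Continuous ψ'
  equation : ∀ t, HasDerivAt (fun t => P.density n c t / P.coeffAxial c t * ψ' t)
    (((n - 1) / P.coeffSphere c t - V t) * P.density n c t * ψ t) t
  growth : ∃ C, 0 < C ∧ ∀ t,
    1 ≤ C * (1 + Real.exp (2 * t)) * (P.density n c t / P.coeffAxial c t * ψ t ^ 2) ∧
    1 ≤ C * (1 + Real.exp (2 * t)) * (P.density n c t * ψ t ^ 2)

lemma exists_cyl {n : ℕ} (hn : 1 ≤ n) (t : ℝ) : ∃ p : Cyl n, p.1 = t :=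
  ⟨(t, ⟨EuclideanSpace.single ⟨0, hn⟩ 1, by simp⟩), rfl⟩

/-! ### The Jacobi factor of a Euclidean unduloid -/

section Euclidean
variable {f : ℝ → ℝ}

lemma regular_euclideanProfile (hf : ContDiff ℝ ∞ f) (hpos : ∀ x, 0 < f x) :
    (euclideanProfile f).Regular .euclidean where
  axial := contDiff_id
  radial := hf
  radial_pos := hpos
  scale_pos := fun _ => one_pos
  speed_pos := fun t => by
    simp only [euclideanProfile, deriv_id'']
    positivity

lemma coeffAxial_euclideanProfile (t : ℝ) :
    (euclideanProfile f).coeffAxial .euclidean t = 1 + deriv f t ^ 2 := by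
  simp [Profile.coeffAxial, euclideanProfile, SpaceForm.scale]

lemma coeffSphere_euclideanProfile (t : ℝ) :
    (euclideanProfile f).coeffSphere .euclidean t = f t ^ 2 := by
  simp [Profile.coeffSphere, euclideanProfile, SpaceForm.scale]

lemma curvSphere_euclideanProfile (t : ℝ) :
    (euclideanProfile f).curvSphere .euclidean t = 1 / (√(1 + deriv f t ^ 2) * f t) := by
  simp [Profile.curvSphere, Profile.speed, euclideanProfile, SpaceForm.scale, SpaceForm.scaleDeriv]

lemma curvAxial_euclideanProfile (t : ℝ) :
    (euclideanProfile f).curvAxial .euclidean t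
      = -deriv (deriv f) t / √(1 + deriv f t ^ 2) ^ 3 := by
  simp [Profile.curvAxial, Profile.speed, euclideanProfile, SpaceForm.scale, SpaceForm.scaleDeriv]

lemma density_euclideanProfile (n : ℕ) (hpos : ∀ x, 0 < f x) (t : ℝ) :
    (euclideanProfile f).density n .euclidean t = √(1 + deriv f t ^ 2) * f t ^ (n - 1) := by
  rw [Profile.density, coeffAxial_euclideanProfile, coeffSphere_euclideanProfile,
    Real.sqrt_mul (by positivity), ← pow_mul, mul_comm 2, pow_mul,
    Real.sqrt_sq (pow_pos (hpos t) _).le]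

/-- The factor `ψ = 1 / √(1 + f'²)` comes from the Euclidean translations orthogonal to the axis.
Positivity of `μ` confines `f` between `μ` and `1` and keeps `ψ ≥ μ`, so all the bounds are uniform
in `t`. -/
lemma isJacobiFactor_euclidean {n : ℕ} (hn : 2 ≤ n) {μ : ℝ} (hμ : 0 < μ) (hf : ContDiff ℝ ∞ f)
    (hpos : ∀ x, 0 < f x) (hc : ∀ x, μ = f x ^ (n - 1) / √(1 + deriv f x ^ 2) - f x ^ n)
    (hm : ∀ p : Cyl n, meanCurvature .euclidean (euclideanProfile f) p = 1) :
    ∃ V ψ ψ', IsJacobiFactor n .euclidean (euclideanProfile f) V ψ ψ' := by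
  have hR := regular_euclideanProfile hf hpos
  have hn0 : (n : ℝ) ≠ 0 := by positivity
  obtain ⟨k, rfl⟩ : ∃ k, n = k + 2 := ⟨n - 2, by omega⟩
  have hk1 : k + 2 - 1 = k + 1 := by omega
  rw [hk1] at hc
  have hW : ∀ t, 0 < √(1 + deriv f t ^ 2) := fun t => Real.sqrt_pos.2 (by positivity)
  have hWsq : ∀ t, √(1 + deriv f t ^ 2) ^ 2 = 1 + deriv f t ^ 2 :=
    fun t => Real.sq_sqrt (by positivity)
  have hW1 : ∀ t, 1 ≤ √(1 + deriv f t ^ 2) := fun t => Real.one_le_sqrt.2 (by nlinarith)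
  have hle : ∀ t, μ + f t ^ (k + 2) ≤ f t ^ (k + 1) := fun t => by
    have := hc t
    have h2 := div_le_self (pow_pos (hpos t) (k + 1)).le (hW1 t)
    linarith
  have hf1 : ∀ t, f t < 1 := fun t => by
    have h1 := hle t
    have h2 := pow_pos (hpos t) (k + 1)
    rw [pow_succ] at h1
    nlinarith
  have hfμ' : ∀ t, μ ≤ f t ^ (k + 1) := fun t => by
    linarith [hle t, pow_pos (hpos t) (k + 2)]
  have hfμ : ∀ t, μ ≤ f t := fun t =>
    (hfμ' t).trans (pow_le_of_le_one (hpos t).le (hf1 t).le (by omega))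
  -- The equation defining `μ`, divided by `f ^ n`, is a formula for the spherical principal
  -- curvature.
  have hκ2 : ∀ t, 1 / (√(1 + deriv f t ^ 2) * f t) = 1 + μ / f t ^ (k + 2) := fun t => by
    have h1 := (hpos t).ne'
    have h2 := (hW t).ne'
    rw [hc t]
    field_simp
    ring
  -- The axial curvature is read off from the mean curvature. Differentiating the first integral
  -- would give no information where `f' = 0`.
  have hκ1 : ∀ t, -deriv (deriv f) t / √(1 + deriv f t ^ 2) ^ 3
      = 1 - (k + 1) * (μ / f t ^ (k + 2)) := fun t => by
    obtain ⟨p, rfl⟩ := exists_cyl (n := k + 2) (by omega) t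
    have h1 := hm p
    rw [hR.meanCurvature_eq (by omega), curvAxial_euclideanProfile, curvSphere_euclideanProfile,
      hκ2, div_eq_iff hn0] at h1
    push_cast at h1
    linear_combination h1
  have hdf : Differentiable ℝ f := hf.differentiable (by simp)
  have hd1 : ContDiff ℝ ∞ (deriv f) := (contDiff_infty_iff_deriv.1 hf).2
  have hddf : Differentiable ℝ (deriv f) := hd1.differentiable (by simp)
  have hp : ∀ t, (euclideanProfile f).density (k + 2) .euclidean t
      / (euclideanProfile f).coeffAxial .euclidean t = μ + f t ^ (k + 2) := fun t => by
    rw [density_euclideanProfile _ hpos, coeffAxial_euclideanProfile, hk1]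
    have h2 := (hW t).ne'
    have h3 := hWsq t
    have h4 := hc t
    generalize √(1 + deriv f t ^ 2) = W at h2 h3 h4 ⊢
    rw [← h3, h4]
    field_simp
    ring
  have hψμ : ∀ t, μ ≤ 1 / √(1 + deriv f t ^ 2) := fun t => by
    have h1 := hc t
    have h2 : f t ^ (k + 1) / √(1 + deriv f t ^ 2) ≤ 1 / √(1 + deriv f t ^ 2) := by
      have := hW t
      gcongr
      exact pow_le_one₀ (hpos t).le (hf1 t).le
    linarith [pow_pos (hpos t) (k + 2)]
  refine ⟨fun t => (1 - (k + 1) * (μ / f t ^ (k + 2))) ^ 2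
      + (k + 1) * (1 + μ / f t ^ (k + 2)) ^ 2, fun t => 1 / √(1 + deriv f t ^ 2),
    fun t => deriv f t * (1 - (k + 1) * (μ / f t ^ (k + 2))), hR, ?_, ?_, ?_, ?_, ?_, ?_, ?_, ?_⟩
  · intro p
    rw [hR.potential_eq (by omega), curvAxial_euclideanProfile, curvSphere_euclideanProfile,
      hκ2, hκ1]
    simp [SpaceForm.curvature]
    left; ring
  · have : ∀ t, f t ^ (k + 2) ≠ 0 := fun t => (pow_pos (hpos t) _).ne'
    have := hdf.continuous
    fun_prop (disch := assumption)
  · refine ⟨(1 + (k + 1) * (1 / μ)) ^ 2 + (k + 1) * (1 + 1 / μ) ^ 2, fun t => ?_⟩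
    have h1 : μ / f t ^ (k + 2) ≤ 1 / μ := by
      rw [div_le_div_iff₀ (pow_pos (hpos t) _) hμ, pow_succ]
      have := mul_le_mul (hfμ' t) (hfμ t) hμ.le (hμ.le.trans (hfμ' t))
      linarith
    have h2 : 0 < μ / f t ^ (k + 2) := div_pos hμ (pow_pos (hpos t) _)
    rw [abs_of_nonneg (by positivity)]
    have h3 : (0 : ℝ) ≤ k := k.cast_nonneg
    have h4 : (k + 1) * (μ / f t ^ (k + 2)) ≤ (k + 1) * (1 / μ) := by gcongr
    have h5 : 0 < (k + 1) * (μ / f t ^ (k + 2)) := by positivity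
    gcongr ?_ + (k + 1) * (1 + ?_) ^ 2
    exact sq_le_sq' (by linarith) (by linarith)
  · intro t
    exact one_div_pos.2 (hW t)
  · intro t
    have h1 := (hddf t).hasDerivAt
    have h2 := ((h1.fun_pow 2).const_add 1).sqrt (by positivity)
    have h3 := h2.fun_inv (hW t).ne'
    simp only [one_div]
    refine h3.congr_deriv ?_
    rw [← hκ1]
    have := (hW t).ne'
    field_simp
    simp
    ring
  · have h1 : ∀ t, f t ^ (k + 2) ≠ 0 := fun t => (pow_pos (hpos t) _).ne'
    have h2 := hdf.continuous
    have h3 := hddf.continuous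
    fun_prop (disch := assumption)
  · intro t
    have h1 : f t ^ (k + 2) ≠ 0 := (pow_pos (hpos t) _).ne'
    have h0 := (hdf t).hasDerivAt
    have h00 := (hddf t).hasDerivAt
    simp only [hp]
    have h2 := (h0.fun_pow (k + 2)).const_add μ
    have h3 := (((hasDerivAt_const t μ).fun_div (h0.fun_pow (k + 2)) h1).const_mul
      ((k : ℝ) + 1)).const_sub 1
    refine (h2.fun_mul (h00.fun_mul h3)).congr_deriv ?_
    rw [density_euclideanProfile _ hpos, coeffSphere_euclideanProfile]
    -- Eliminating `f''` through the axial curvature and `μ` through the spherical one leaves an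
    -- algebraic identity in `f`, `f'` and `W`, subject to `W² = 1 + f'²`.
    have h4 : deriv (deriv f) t = -(1 - (k + 1) * (μ / f t ^ (k + 2)))
        * √(1 + deriv f t ^ 2) ^ 3 := by
      rw [← hκ1]
      have := (hW t).ne'
      field_simp
    have h5 : μ / f t ^ (k + 2) = 1 / (√(1 + deriv f t ^ 2) * f t) - 1 := by
      rw [hκ2]; ring
    have h6 : μ = (1 / (√(1 + deriv f t ^ 2) * f t) - 1) * f t ^ (k + 2) := by
      rw [← h5]; field_simp
    have h7 := hWsq t
    rw [h4, h5, h6]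
    have h8 := hpos t
    have h9 := hW t
    generalize √(1 + deriv f t ^ 2) = W at *
    generalize deriv f t = f' at *
    generalize f t = x at *
    push_cast
    have : f' ^ 2 = W ^ 2 - 1 := by linarith
    field_simp
    ring_nf
    simp only [this]
    ring
  -- The two summands match the lower bounds `μ · μ²` for `p ψ²` and `μ · μ` for `D ψ²`. The factor
  -- `1 + exp (2 t)` is needed only in the hyperbolic case.
  · refine ⟨1 / μ ^ 3 + 1 / μ ^ 2, by positivity, fun t => ?_⟩
    have h1 := hψμ t
    have h2 := hfμ' t
    have h3 := hpos t
    have h4 := hW t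
    have h5 := Real.exp_pos (2 * t)
    have h6 : 1 / μ ^ 3 + 1 / μ ^ 2 ≤ (1 / μ ^ 3 + 1 / μ ^ 2) * (1 + Real.exp (2 * t)) :=
      le_mul_of_one_le_right (by positivity) (by linarith)
    constructor
    · rw [hp]
      calc (1 : ℝ) ≤ (1 / μ ^ 3 + 1 / μ ^ 2) * μ ^ 3 := by
            field_simp; linarith
        _ = (1 / μ ^ 3 + 1 / μ ^ 2) * (μ * μ ^ 2) := by ring
        _ ≤ (1 / μ ^ 3 + 1 / μ ^ 2) * (1 + Real.exp (2 * t))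
            * ((μ + f t ^ (k + 2)) * (1 / √(1 + deriv f t ^ 2)) ^ 2) := by
            gcongr
            linarith [pow_pos (hpos t) (k + 2)]
    · rw [density_euclideanProfile _ hpos, hk1]
      calc (1 : ℝ) ≤ (1 / μ ^ 3 + 1 / μ ^ 2) * (μ * μ) := by
            field_simp; linarith
        _ ≤ (1 / μ ^ 3 + 1 / μ ^ 2) * (1 + Real.exp (2 * t))
            * (f t ^ (k + 1) * (1 / √(1 + deriv f t ^ 2))) := by
            gcongr
        _ = _ := by field_simp

end Euclidean

/-! ### Geometry of a hyperbolic hypersurface of revolution in polar coordinates -/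

section Hyperbolic
variable {φ : ℝ → ℝ}

/-- Functions of the form `e^t (g cos φ + h sin φ)` are closed under differentiation, so this one
rule gives the first and second derivatives of both profile coordinates. -/
lemma hasDerivAt_exp_mul_cos {g g' h h' : ℝ → ℝ} (hφ : Differentiable ℝ φ)
    (hg : ∀ t, HasDerivAt g (g' t) t) (hh : ∀ t, HasDerivAt h (h' t) t) (t : ℝ) :
    HasDerivAt (fun t => Real.exp t * (g t * Real.cos (φ t) + h t * Real.sin (φ t)))
      (Real.exp t * ((g t + g' t + h t * deriv φ t) * Real.cos (φ t)
        + (h t + h' t - g t * deriv φ t) * Real.sin (φ t))) t := by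
  have h1 := (hφ t).hasDerivAt
  refine ((Real.hasDerivAt_exp t).fun_mul (((hg t).fun_mul h1.cos).fun_add
    ((hh t).fun_mul h1.sin))).congr_deriv ?_
  ring

/-- The factor `1` is kept so that the right side has the shape to which `hasDerivAt_exp_mul_cos`
applies a second time. -/
lemma deriv_axial_hyperbolicProfile (hφ : Differentiable ℝ φ) :
    deriv (hyperbolicProfile φ).axial = fun t =>
      Real.exp t * (1 * Real.cos (φ t) + -deriv φ t * Real.sin (φ t)) := by
  funext t
  have := hasDerivAt_exp_mul_cos (g := fun _ => 1) (h := fun _ => 0) hφ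
    (fun t => hasDerivAt_const t 1) (fun t => hasDerivAt_const t 0) t
  rw [show (hyperbolicProfile φ).axial = fun t => Real.exp t * (1 * Real.cos (φ t)
    + 0 * Real.sin (φ t)) from funext fun t => by simp [hyperbolicProfile], this.deriv]
  ring

lemma deriv_radial_hyperbolicProfile (hφ : Differentiable ℝ φ) :
    deriv (hyperbolicProfile φ).radial = fun t =>
      Real.exp t * (deriv φ t * Real.cos (φ t) + 1 * Real.sin (φ t)) := by
  funext t
  have := hasDerivAt_exp_mul_cos (g := fun _ => 0) (h := fun _ => 1) hφ
    (fun t => hasDerivAt_const t 0) (fun t => hasDerivAt_const t 1) t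
  rw [show (hyperbolicProfile φ).radial = fun t => Real.exp t * (0 * Real.cos (φ t)
    + 1 * Real.sin (φ t)) from funext fun t => by simp [hyperbolicProfile], this.deriv]
  ring

lemma sq_speed_hyperbolicProfile (hφ : Differentiable ℝ φ) (t : ℝ) :
    deriv (hyperbolicProfile φ).axial t ^ 2 + deriv (hyperbolicProfile φ).radial t ^ 2
      = Real.exp t ^ 2 * (1 + deriv φ t ^ 2) := by
  rw [deriv_axial_hyperbolicProfile hφ, deriv_radial_hyperbolicProfile hφ]
  linear_combination (Real.exp t ^ 2 * (1 + deriv φ t ^ 2)) * Real.sin_sq_add_cos_sq (φ t)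

lemma speed_hyperbolicProfile (hφ : Differentiable ℝ φ) (t : ℝ) :
    (hyperbolicProfile φ).speed t = Real.exp t * √(1 + deriv φ t ^ 2) := by
  rw [Profile.speed, sq_speed_hyperbolicProfile hφ, Real.sqrt_mul (by positivity),
    Real.sqrt_sq (Real.exp_pos t).le]

lemma cos_pos_of_angle (hb : ∀ t, 0 < φ t ∧ φ t < Real.pi / 2) (t : ℝ) : 0 < Real.cos (φ t) :=
  Real.cos_pos_of_mem_Ioo ⟨by linarith [hb t, Real.pi_pos], (hb t).2⟩

lemma sin_pos_of_angle (hb : ∀ t, 0 < φ t ∧ φ t < Real.pi / 2) (t : ℝ) : 0 < Real.sin (φ t) :=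
  Real.sin_pos_of_pos_of_lt_pi (hb t).1 (by linarith [hb t, Real.pi_pos])

lemma regular_hyperbolicProfile (hφ : ContDiff ℝ ∞ φ) (hb : ∀ t, 0 < φ t ∧ φ t < Real.pi / 2) :
    (hyperbolicProfile φ).Regular .hyperbolic where
  axial := Real.contDiff_exp.mul hφ.cos
  radial := Real.contDiff_exp.mul hφ.sin
  radial_pos := fun t => mul_pos (Real.exp_pos t) (sin_pos_of_angle hb t)
  scale_pos := fun t => mul_pos (Real.exp_pos t) (cos_pos_of_angle hb t)
  speed_pos := fun t => by
    rw [sq_speed_hyperbolicProfile (hφ.differentiable (by simp))]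
    positivity

lemma coeffAxial_hyperbolicProfile (hφ : Differentiable ℝ φ) (t : ℝ) :
    (hyperbolicProfile φ).coeffAxial .hyperbolic t
      = (1 + deriv φ t ^ 2) / Real.cos (φ t) ^ 2 := by
  rw [Profile.coeffAxial, sq_speed_hyperbolicProfile hφ]
  simp only [SpaceForm.scale, hyperbolicProfile, mul_pow]
  exact mul_div_mul_left _ _ (by positivity)

lemma coeffSphere_hyperbolicProfile (t : ℝ) :
    (hyperbolicProfile φ).coeffSphere .hyperbolic t = Real.tan (φ t) ^ 2 := by
  simp only [Profile.coeffSphere, SpaceForm.scale, hyperbolicProfile, mul_pow,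
    Real.tan_eq_sin_div_cos, div_pow]
  exact mul_div_mul_left _ _ (by positivity)

lemma curvSphere_hyperbolicProfile (hφ : Differentiable ℝ φ)
    (hb : ∀ t, 0 < φ t ∧ φ t < Real.pi / 2) (t : ℝ) :
    (hyperbolicProfile φ).curvSphere .hyperbolic t
      = 1 / (√(1 + deriv φ t ^ 2) * Real.sin (φ t)) := by
  have hW : 0 < √(1 + deriv φ t ^ 2) := Real.sqrt_pos.2 (by positivity)
  have hs := sin_pos_of_angle hb t
  have h1 := Real.sin_sq_add_cos_sq (φ t)
  simp only [Profile.curvSphere, speed_hyperbolicProfile hφ, SpaceForm.scale,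
    SpaceForm.scaleDeriv, deriv_axial_hyperbolicProfile hφ, deriv_radial_hyperbolicProfile hφ]
  simp only [hyperbolicProfile]
  field_simp
  linear_combination h1

lemma curvAxial_hyperbolicProfile (hφ : Differentiable ℝ φ) (hdφ : Differentiable ℝ (deriv φ))
    (t : ℝ) :
    (hyperbolicProfile φ).curvAxial .hyperbolic t
      = -Real.cos (φ t) * deriv (deriv φ) t / √(1 + deriv φ t ^ 2) ^ 3
        + Real.sin (φ t) / √(1 + deriv φ t ^ 2) := by
  have hW : 0 < √(1 + deriv φ t ^ 2) := Real.sqrt_pos.2 (by positivity)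
  have hWsq : √(1 + deriv φ t ^ 2) ^ 2 = 1 + deriv φ t ^ 2 := Real.sq_sqrt (by positivity)
  have h1 := Real.sin_sq_add_cos_sq (φ t)
  have ha := hasDerivAt_exp_mul_cos (g := fun _ => 1) (h := fun t => -deriv φ t) hφ
    (fun t => hasDerivAt_const t 1) (fun t => (hdφ t).hasDerivAt.fun_neg) t
  have hr := hasDerivAt_exp_mul_cos (g := fun t => deriv φ t) (h := fun _ => 1) hφ
    (fun t => (hdφ t).hasDerivAt) (fun t => hasDerivAt_const t 1) t
  simp only [Profile.curvAxial, speed_hyperbolicProfile hφ, SpaceForm.scale,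
    SpaceForm.scaleDeriv, deriv_axial_hyperbolicProfile hφ, deriv_radial_hyperbolicProfile hφ,
    ha.deriv, hr.deriv]
  simp only [hyperbolicProfile]
  generalize √(1 + deriv φ t ^ 2) = W at *
  generalize deriv φ t = q at *
  generalize Real.cos (φ t) = x at *
  generalize Real.sin (φ t) = y at *
  field_simp
  rw [hWsq]
  linear_combination (-x * (deriv (deriv φ) t + q + q ^ 3)) * h1

lemma density_hyperbolicProfile (n : ℕ) (hφ : Differentiable ℝ φ)
    (hb : ∀ t, 0 < φ t ∧ φ t < Real.pi / 2) (t : ℝ) :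
    (hyperbolicProfile φ).density n .hyperbolic t
      = √(1 + deriv φ t ^ 2) / Real.cos (φ t) * Real.tan (φ t) ^ (n - 1) := by
  have hc := cos_pos_of_angle hb t
  have hT : 0 < Real.tan (φ t) := Real.tan_pos_of_pos_of_lt_pi_div_two (hb t).1 (hb t).2
  rw [Profile.density, coeffAxial_hyperbolicProfile hφ, coeffSphere_hyperbolicProfile,
    Real.sqrt_mul (by positivity), ← pow_mul, mul_comm 2, pow_mul,
    Real.sqrt_sq (by positivity), Real.sqrt_div (by positivity), Real.sqrt_sq hc.le]

end Hyperbolic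

/-! ### The Jacobi factor of a hyperbolic unduloid -/

section Hyperbolic
variable {φ : ℝ → ℝ}

/-- The algebraic content of the Jacobi equation for a hyperbolic unduloid: `x`, `y` are the
cosine and sine of the angle, `q` its derivative, `κ` the axial principal curvature. -/
lemma hyperbolic_jacobi_identity {x y q W κ k : ℝ} (hx : x ≠ 0) (hy : y ≠ 0) (hW : W ≠ 0)
    (h1 : y ^ 2 + x ^ 2 = 1) (h2 : W ^ 2 = 1 + q ^ 2) :
    ((k + 1) * (q / x ^ 2) / (y / x) - 1) * (κ * (q + y / x) / W - 1 / x)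
      + (((k + 1) * (1 / (W * y) - κ) * (q / (x * y)) * (q + y / x)
        + κ * ((W ^ 2 * y - W ^ 3 * κ) / x + q / x ^ 2)) / W
        - κ * (q + y / x) * (q * ((W ^ 2 * y - W ^ 3 * κ) / x) / W) / W ^ 2
        - y * q / x ^ 2)
      = ((k + 1) / (y / x) ^ 2 + (k + 2) - κ ^ 2 - (k + 1) * (1 / (W * y)) ^ 2)
        * ((1 - q * (y / x)) / x) := by
  have hq2 : q ^ 2 = W ^ 2 - 1 := by linarith
  have hy2 : y ^ 2 = 1 - x ^ 2 := by linarith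
  have hy3 : y ^ 3 = y * (1 - x ^ 2) := by rw [← hy2]; ring
  have hy4 : y ^ 4 = (1 - x ^ 2) ^ 2 := by rw [← hy2]; ring
  field_simp
  ring_nf
  simp only [hq2, hy2, hy3, hy4]
  ring

/-- The algebraic content of the formula for the derivative of the Jacobi factor. -/
lemma hyperbolic_factor_identity {x y q W κ : ℝ} (hx : x ≠ 0) (hW : W ≠ 0)
    (h1 : y ^ 2 + x ^ 2 = 1) (h2 : W ^ 2 = 1 + q ^ 2) :
    -((1 - q * (y / x)) / W) + (-((W ^ 2 * y - W ^ 3 * κ) / x * (y / x) + q * (q / x ^ 2)) * W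
      - (1 - q * (y / x)) * (q * ((W ^ 2 * y - W ^ 3 * κ) / x) / W)) / W ^ 2
      = κ * (q + y / x) / x - W / x ^ 2 := by
  have hq2 : q ^ 2 = W ^ 2 - 1 := by linarith
  have hy2 : y ^ 2 = 1 - x ^ 2 := by linarith
  field_simp
  ring_nf
  simp only [hq2, hy2]
  ring

/-- Horizontal translations `z ↦ z + s θ` are isometries of the half-space. The normal component of
their Killing field is, up to sign, `⟨θ, ω⟩` times `axial' / (axial · speed)`, which is the `ψ` used
here. It is positive because `H > 1` and `μ > 0` force `|φ' tan φ| ≤ 1 / H < 1`. -/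
lemma isJacobiFactor_hyperbolic {n : ℕ} (hn : 2 ≤ n) {H μ : ℝ} (hH : 1 < H) (hμ : 0 < μ)
    (hφ : ContDiff ℝ ∞ φ) (hb : ∀ t, 0 < φ t ∧ φ t < Real.pi / 2)
    (hc : ∀ t, μ = Real.tan (φ t) ^ (n - 1) / (Real.cos (φ t) * √(1 + deriv φ t ^ 2))
        - H * Real.tan (φ t) ^ n)
    (hm : ∀ p : Cyl n, meanCurvature .hyperbolic (hyperbolicProfile φ) p = H) :
    ∃ V ψ ψ', IsJacobiFactor n .hyperbolic (hyperbolicProfile φ) V ψ ψ' := by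
  have hR := regular_hyperbolicProfile hφ hb
  have hn0 : (n : ℝ) ≠ 0 := by positivity
  obtain ⟨k, rfl⟩ : ∃ k, n = k + 2 := ⟨n - 2, by omega⟩
  have hk1 : k + 2 - 1 = k + 1 := by omega
  rw [hk1] at hc
  have hdφ : Differentiable ℝ φ := hφ.differentiable (by simp)
  have hd1 : ContDiff ℝ ∞ (deriv φ) := (contDiff_infty_iff_deriv.1 hφ).2
  have hddφ : Differentiable ℝ (deriv φ) := hd1.differentiable (by simp)
  have hcos := cos_pos_of_angle hb
  have hsin := sin_pos_of_angle hb
  have hT : ∀ t, 0 < Real.tan (φ t) := fun t =>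
    Real.tan_pos_of_pos_of_lt_pi_div_two (hb t).1 (hb t).2
  have hW : ∀ t, 0 < √(1 + deriv φ t ^ 2) := fun t => Real.sqrt_pos.2 (by positivity)
  have hWsq : ∀ t, √(1 + deriv φ t ^ 2) ^ 2 = 1 + deriv φ t ^ 2 :=
    fun t => Real.sq_sqrt (by positivity)
  have hW1 : ∀ t, 1 ≤ √(1 + deriv φ t ^ 2) := fun t => Real.one_le_sqrt.2 (by nlinarith)
  have hTn : ∀ t, 0 < μ / Real.tan (φ t) ^ (k + 2) := fun t => div_pos hμ (pow_pos (hT t) _)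
  have hκ2 : ∀ t, 1 / (√(1 + deriv φ t ^ 2) * Real.sin (φ t))
      = H + μ / Real.tan (φ t) ^ (k + 2) := fun t => by
    have h1 := (hT t).ne'
    have h2 := (hW t).ne'
    have h3 := (hcos t).ne'
    have h4 := (hsin t).ne'
    have h5 : Real.sin (φ t) = Real.tan (φ t) * Real.cos (φ t) := (Real.tan_mul_cos h3).symm
    rw [hc t, h5]
    field_simp
    ring
  -- As in the Euclidean case, the mean curvature condition determines the axial curvature, hence
  -- `φ''`, even where `φ' = 0`.
  have hκ1 : ∀ t, -Real.cos (φ t) * deriv (deriv φ) t / √(1 + deriv φ t ^ 2) ^ 3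
        + Real.sin (φ t) / √(1 + deriv φ t ^ 2)
      = H - (k + 1) * (μ / Real.tan (φ t) ^ (k + 2)) := fun t => by
    obtain ⟨p, rfl⟩ := exists_cyl (n := k + 2) (by omega) t
    have h1 := hm p
    rw [hR.meanCurvature_eq (by omega), curvAxial_hyperbolicProfile hdφ hddφ,
      curvSphere_hyperbolicProfile hdφ hb, hκ2, div_eq_iff hn0] at h1
    push_cast at h1
    linear_combination h1
  have hφ2 : ∀ t, deriv (deriv φ) t = (√(1 + deriv φ t ^ 2) ^ 2 * Real.sin (φ t)
      - √(1 + deriv φ t ^ 2) ^ 3 * (H - (k + 1) * (μ / Real.tan (φ t) ^ (k + 2))))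
      / Real.cos (φ t) := fun t => by
    rw [← hκ1]
    have := (hW t).ne'
    have := (hcos t).ne'
    field_simp
    ring
  have hp : ∀ t, (hyperbolicProfile φ).density (k + 2) .hyperbolic t
      / (hyperbolicProfile φ).coeffAxial .hyperbolic t
      = Real.tan (φ t) ^ (k + 1) * Real.cos (φ t) / √(1 + deriv φ t ^ 2) := fun t => by
    rw [density_hyperbolicProfile _ hdφ hb, coeffAxial_hyperbolicProfile hdφ, hk1]
    have h2 := (hW t).ne'
    have h3 := hWsq t
    have h4 := (hcos t).ne'
    generalize √(1 + deriv φ t ^ 2) = W at h2 h3 ⊢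
    rw [← h3]
    field_simp
  -- Since `μ > 0`, the spherical curvature exceeds `H`. All the uniform bounds below use this
  -- inequality.
  have hHs : ∀ t, H * (√(1 + deriv φ t ^ 2) * Real.sin (φ t)) < 1 := fun t => by
    have h1 := hκ2 t
    have h2 := mul_pos (hW t) (hsin t)
    rw [div_eq_iff h2.ne'] at h1
    nlinarith [mul_pos (hTn t) h2]
  have hHs' : ∀ t, H * Real.sin (φ t) < 1 := fun t => by
    refine lt_of_le_of_lt ?_ (hHs t)
    gcongr
    exact le_mul_of_one_le_left (hsin t).le (hW1 t)
  -- As `sin φ < 1 / H` and `H > 1`, the cosine stays above `√(1 - 1 / H²)`.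
  obtain ⟨δ, hδ0, hδ1, hδ⟩ : ∃ δ : ℝ, 0 < δ ∧ δ ≤ 1 ∧ ∀ t, δ ≤ Real.cos (φ t) := by
    have hpos : 0 < 1 - 1 / H ^ 2 := by
      rw [sub_pos, div_lt_one (by positivity)]
      nlinarith
    refine ⟨√(1 - 1 / H ^ 2), Real.sqrt_pos.2 hpos, ?_, fun t => ?_⟩
    · refine Real.sqrt_le_one.2 ?_
      linarith [show 0 < 1 / H ^ 2 by positivity]
    · rw [Real.sqrt_le_left (hcos t).le]
      have h1 : Real.sin (φ t) ≤ 1 / H := by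
        rw [le_div_iff₀ (by linarith)]; linarith [hHs' t]
      have h2 : Real.sin (φ t) ^ 2 ≤ 1 / H ^ 2 := by
        rw [← one_div_pow]
        exact pow_le_pow_left₀ (hsin t).le h1 2
      linarith [Real.sin_sq_add_cos_sq (φ t)]
  -- The first integral gives `tan ^ (n - 1) > μ cos φ √(1 + φ'²) ≥ μ δ`. Taking the minimum with
  -- `1` bounds the tangent itself as well.
  obtain ⟨τ, hτ0, hτ1, hτ⟩ : ∃ τ : ℝ, 0 < τ ∧ (∀ t, τ ≤ Real.tan (φ t)) ∧
      ∀ t, τ ≤ Real.tan (φ t) ^ (k + 1) := by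
    have h1 : ∀ t, μ * δ ≤ Real.tan (φ t) ^ (k + 1) := fun t => by
      have h2 := hc t
      have h3 : μ < Real.tan (φ t) ^ (k + 1) / (Real.cos (φ t) * √(1 + deriv φ t ^ 2)) := by
        have : 0 < H * Real.tan (φ t) ^ (k + 2) := mul_pos (by linarith) (pow_pos (hT t) _)
        linarith
      rw [lt_div_iff₀ (mul_pos (hcos t) (hW t))] at h3
      refine le_trans ?_ h3.le
      gcongr
      exact (hδ t).trans (le_mul_of_one_le_right (hcos t).le (hW1 t))
    refine ⟨min 1 (μ * δ), lt_min one_pos (by positivity), fun t => ?_,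
      fun t => (min_le_right _ _).trans (h1 t)⟩
    rcases le_total 1 (Real.tan (φ t)) with h | h
    · exact (min_le_left _ _).trans h
    · exact (min_le_right _ _).trans
        ((h1 t).trans (pow_le_of_le_one (hT t).le h (by omega)))
  have hWinv : ∀ t, τ * δ ≤ 1 / √(1 + deriv φ t ^ 2) := fun t => by
    rw [le_div_iff₀ (hW t)]
    have h3 : τ * δ ≤ Real.sin (φ t) := by
      rw [← Real.tan_mul_cos (hcos t).ne']
      exact mul_le_mul (hτ1 t) (hδ t) hδ0.le (hT t).le
    have h4 := hHs t
    have h5 : τ * δ * √(1 + deriv φ t ^ 2) ≤ √(1 + deriv φ t ^ 2) * Real.sin (φ t) := by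
      rw [mul_comm]; exact mul_le_mul_of_nonneg_left h3 (hW t).le
    nlinarith [mul_pos (hW t) (hsin t)]
  -- With `W² = 1 + φ'²`, the claim `(φ' tan φ)² ≤ 1 / H²` reads `H² W² sin² φ ≤ 1 + (H² - 1) sin²
  -- φ`, which follows from `H W sin φ < 1`.
  have hβ : ∀ t, 1 - 1 / H ≤ 1 - deriv φ t * Real.tan (φ t) := fun t => by
    have h1 := hHs t
    have h2 := Real.sin_sq_add_cos_sq (φ t)
    have h3 : (deriv φ t * Real.tan (φ t)) ^ 2 ≤ (1 / H) ^ 2 := by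
      have hq : deriv φ t ^ 2 = √(1 + deriv φ t ^ 2) ^ 2 - 1 := by rw [hWsq]; ring
      rw [mul_pow, hq, Real.tan_eq_sin_div_cos, div_pow, one_div_pow, mul_div_assoc',
        div_le_div_iff₀ (pow_pos (hcos t) 2) (by positivity)]
      have h4 : (H * (√(1 + deriv φ t ^ 2) * Real.sin (φ t))) ^ 2 ≤ 1 :=
        pow_le_one₀ (mul_nonneg (by linarith) (mul_pos (hW t) (hsin t)).le) h1.le
      nlinarith [mul_nonneg (sq_nonneg (Real.sin (φ t))) (show 0 ≤ H ^ 2 - 1 by nlinarith)]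
    have := abs_le_of_sq_le_sq' h3 (by positivity)
    linarith [this.2]
  have hβ0 : 0 < 1 - 1 / H := by
    rw [sub_pos, div_lt_one (by linarith)]; exact hH
  refine ⟨fun t => -(k + 2) + (H - (k + 1) * (μ / Real.tan (φ t) ^ (k + 2))) ^ 2
      + (k + 1) * (H + μ / Real.tan (φ t) ^ (k + 2)) ^ 2,
    fun t => Real.exp (-t) * ((1 - deriv φ t * Real.tan (φ t)) / √(1 + deriv φ t ^ 2)),
    fun t => Real.exp (-t) * ((H - (k + 1) * (μ / Real.tan (φ t) ^ (k + 2)))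
      * (deriv φ t + Real.tan (φ t)) / Real.cos (φ t)
      - √(1 + deriv φ t ^ 2) / Real.cos (φ t) ^ 2), hR, ?_, ?_, ?_, ?_, ?_, ?_, ?_, ?_⟩
  · intro p
    rw [hR.potential_eq (by omega), curvAxial_hyperbolicProfile hdφ hddφ,
      curvSphere_hyperbolicProfile hdφ hb, hκ2, hκ1]
    simp only [SpaceForm.curvature]
    push_cast
    ring
  · have h1 : ∀ t, Real.tan (φ t) ^ (k + 2) ≠ 0 := fun t => (pow_pos (hT t) _).ne'
    have h2 : Continuous fun t => Real.tan (φ t) := continuous_iff_continuousAt.2 fun t =>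
      ((Real.hasDerivAt_tan (hcos t).ne').continuousAt).comp hdφ.continuous.continuousAt
    fun_prop (disch := assumption)
  · refine ⟨(k + 2) + (H + (k + 1) * (μ / (τ * τ))) ^ 2 + (k + 1) * (H + μ / (τ * τ)) ^ 2,
      fun t => ?_⟩
    have h1 : μ / Real.tan (φ t) ^ (k + 2) ≤ μ / (τ * τ) := by
      rw [pow_succ]
      exact div_le_div_of_nonneg_left hμ.le (by positivity)
        (mul_le_mul (hτ t) (hτ1 t) hτ0.le (pow_pos (hT t) _).le)
    have h2 := hTn t
    have h3 : (0 : ℝ) ≤ k := k.cast_nonneg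
    have h4 : (k + 1) * (μ / Real.tan (φ t) ^ (k + 2)) ≤ (k + 1) * (μ / (τ * τ)) := by gcongr
    have h5 : 0 < (k + 1) * (μ / Real.tan (φ t) ^ (k + 2)) := by positivity
    have h6 : (H - (k + 1) * (μ / Real.tan (φ t) ^ (k + 2))) ^ 2
        ≤ (H + (k + 1) * (μ / (τ * τ))) ^ 2 := sq_le_sq' (by linarith) (by linarith)
    have h7 : (k + 1) * (H + μ / Real.tan (φ t) ^ (k + 2)) ^ 2
        ≤ (k + 1) * (H + μ / (τ * τ)) ^ 2 := by gcongr
    have h8 : 0 ≤ (H - (k + 1) * (μ / Real.tan (φ t) ^ (k + 2))) ^ 2 := by positivity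
    have h9 : 0 ≤ (k + 1) * (H + μ / Real.tan (φ t) ^ (k + 2)) ^ 2 := by positivity
    rw [abs_le]
    constructor <;> linarith
  · intro t
    have h1 := hβ t
    exact mul_pos (Real.exp_pos _) (div_pos (by linarith) (hW t))
  · intro t
    have h0 := (hdφ t).hasDerivAt
    have h1 := (hddφ t).hasDerivAt
    have h2 := ((h1.fun_pow 2).const_add 1).sqrt (by positivity)
    have h3 := (Real.hasDerivAt_tan (hcos t).ne').comp t h0
    have h4 := ((h1.fun_mul h3).const_sub 1).fun_div h2 (hW t).ne'
    have h5 := ((hasDerivAt_id t).neg.exp).fun_mul h4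
    refine h5.congr_deriv ?_
    have key := hyperbolic_factor_identity
      (κ := H - (k + 1) * (μ / Real.tan (φ t) ^ (k + 2))) (hcos t).ne' (hW t).ne'
      (Real.sin_sq_add_cos_sq (φ t)) (hWsq t)
    rw [← Real.tan_eq_sin_div_cos, ← hφ2] at key
    simp only [Function.comp_apply, Pi.neg_apply, id]
    linear_combination Real.exp (-t) * key
  · have h1 : ∀ t, Real.tan (φ t) ^ (k + 2) ≠ 0 := fun t => (pow_pos (hT t) _).ne'
    have h2 : Continuous fun t => Real.tan (φ t) := continuous_iff_continuousAt.2 fun t =>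
      ((Real.hasDerivAt_tan (hcos t).ne').continuousAt).comp hdφ.continuous.continuousAt
    have h3 := hdφ.continuous
    have h4 := hddφ.continuous
    have h5 := fun t => (hcos t).ne'
    have h6 : ∀ t, Real.cos (φ t) ^ 2 ≠ 0 := fun t => (pow_pos (hcos t) 2).ne'
    fun_prop (disch := assumption)
  · intro t
    have hx := (hcos t).ne'
    have hy := (hsin t).ne'
    have hT0 := (hT t).ne'
    have hW0 := (hW t).ne'
    have h0 := (hdφ t).hasDerivAt
    have h1 := (hddφ t).hasDerivAt
    have h2 := ((h1.fun_pow 2).const_add 1).sqrt (by positivity)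
    have h3 : HasDerivAt (fun t => Real.tan (φ t)) (deriv φ t / Real.cos (φ t) ^ 2) t :=
      ((Real.hasDerivAt_tan hx).comp t h0).congr_deriv (by ring)
    have hTq : deriv φ t / Real.cos (φ t) ^ 2
        = Real.tan (φ t) * (deriv φ t / (Real.cos (φ t) * Real.sin (φ t))) := by
      rw [Real.tan_eq_sin_div_cos]
      field_simp
    have h4 : HasDerivAt (fun t => Real.tan (φ t) ^ (k + 1))
        (Real.tan (φ t) ^ (k + 1) * ((k + 1) * (deriv φ t / Real.cos (φ t) ^ 2)
          / Real.tan (φ t))) t := by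
      refine (h3.fun_pow (k + 1)).congr_deriv ?_
      push_cast
      field_simp
      ring
    -- The principal curvatures differ by `n μ / tan ^ n`. Hence the derivative of the axial one is
    -- `n - 1` times their difference times `φ' / (cos φ sin φ)`, a form in which `μ` no longer
    -- appears once the axial curvature is named `κ`.
    have h5 : HasDerivAt (fun t => H - (k + 1) * (μ / Real.tan (φ t) ^ (k + 2)))
        ((k + 1) * (1 / (√(1 + deriv φ t ^ 2) * Real.sin (φ t))
          - (H - (k + 1) * (μ / Real.tan (φ t) ^ (k + 2))))
          * (deriv φ t / (Real.cos (φ t) * Real.sin (φ t)))) t := by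
      refine ((((hasDerivAt_const t μ).fun_div (h3.fun_pow (k + 2))
        (pow_ne_zero _ hT0)).const_mul ((k : ℝ) + 1)).const_sub H).congr_deriv ?_
      rw [hκ2, hTq]
      push_cast
      generalize deriv φ t / (Real.cos (φ t) * Real.sin (φ t)) = z
      field_simp
      ring
    have h6 := (((hasDerivAt_id t).neg.exp).fun_mul h4).fun_mul
      (((h5.fun_mul (h1.fun_add h3)).fun_div h2 hW0).fun_sub
        ((hasDerivAt_const t (1 : ℝ)).fun_div h0.cos hx))
    -- Cancelling `cos φ` and `√(1 + φ'²)` in `p ψ'` before differentiating brings it to the form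
    -- treated by `hyperbolic_jacobi_identity`.
    have hfun : (fun t => (hyperbolicProfile φ).density (k + 2) .hyperbolic t
      / (hyperbolicProfile φ).coeffAxial .hyperbolic t *
      (Real.exp (-t) * ((H - (k + 1) * (μ / Real.tan (φ t) ^ (k + 2)))
      * (deriv φ t + Real.tan (φ t)) / Real.cos (φ t)
      - √(1 + deriv φ t ^ 2) / Real.cos (φ t) ^ 2))) = fun t =>
      Real.exp (-t) * Real.tan (φ t) ^ (k + 1) *
        ((H - (k + 1) * (μ / Real.tan (φ t) ^ (k + 2))) * (deriv φ t + Real.tan (φ t))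
          / √(1 + deriv φ t ^ 2) - 1 / Real.cos (φ t)) := by
      funext t
      rw [hp]
      have hx := (hcos t).ne'
      have hW0 := (hW t).ne'
      generalize H - (k + 1) * (μ / Real.tan (φ t) ^ (k + 2)) = κ
      field_simp
    rw [hfun]
    refine h6.congr_deriv ?_
    have key := hyperbolic_jacobi_identity (k := k)
      (κ := H - (k + 1) * (μ / Real.tan (φ t) ^ (k + 2))) hx hy hW0
      (Real.sin_sq_add_cos_sq (φ t)) (hWsq t)
    rw [← Real.tan_eq_sin_div_cos, ← hφ2, hκ2] at key
    rw [hκ2, density_hyperbolicProfile _ hdφ hb, coeffSphere_hyperbolicProfile, hk1]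
    simp only [Pi.neg_apply, id]
    generalize H - (k + 1) * (μ / Real.tan (φ t) ^ (k + 2)) = κ at *
    generalize H + μ / Real.tan (φ t) ^ (k + 2) = κ' at *
    have key2 : √(1 + deriv φ t ^ 2) / Real.cos (φ t) * Real.tan (φ t) ^ (k + 1)
        * (Real.exp (-t) * ((1 - deriv φ t * Real.tan (φ t)) / √(1 + deriv φ t ^ 2)))
        = Real.exp (-t) * Real.tan (φ t) ^ (k + 1)
          * ((1 - deriv φ t * Real.tan (φ t)) / Real.cos (φ t)) := by
      field_simp
    have hdiv : ∀ a b : ℝ, (a * √(1 + deriv φ t ^ 2) - b) / √(1 + deriv φ t ^ 2) ^ 2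
        = a / √(1 + deriv φ t ^ 2) - b / √(1 + deriv φ t ^ 2) ^ 2 := fun a b => by
      field_simp
    push_cast
    rw [mul_assoc _ _ (Real.exp (-t) * _), key2, hdiv]
    linear_combination (Real.exp (-t) * Real.tan (φ t) ^ (k + 1)) * key
  · have hm0 : 0 < τ * δ * (τ * δ) * ((1 - 1 / H) * (τ * δ)) ^ 2 := by positivity
    refine ⟨1 / (τ * δ * (τ * δ) * ((1 - 1 / H) * (τ * δ)) ^ 2)
      + 1 / (τ * ((1 - 1 / H) * (τ * δ)) ^ 2), by positivity, fun t => ?_⟩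
    have hψ : (Real.exp (-t) * ((1 - 1 / H) * (τ * δ))) ^ 2 ≤
        (Real.exp (-t) * ((1 - deriv φ t * Real.tan (φ t)) / √(1 + deriv φ t ^ 2))) ^ 2 := by
      have h1 := hWinv t
      have h2 := hβ t
      rw [div_eq_mul_one_div (1 - deriv φ t * Real.tan (φ t))]
      have h3 : (1 - 1 / H) * (τ * δ)
          ≤ (1 - deriv φ t * Real.tan (φ t)) * (1 / √(1 + deriv φ t ^ 2)) :=
        mul_le_mul h2 h1 (by positivity) (by linarith)
      gcongr
    -- The factor `1 + exp (2 t)` in the growth condition compensates the decay of `e^{-2t}` in `ψ²`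
    -- as `t → ∞`.
    have hexp : 1 ≤ (1 + Real.exp (2 * t)) * Real.exp (-t) ^ 2 := by
      rw [← Real.exp_nat_mul, add_mul, ← Real.exp_add]
      have : 2 * t + ((2 : ℕ) : ℝ) * -t = 0 := by push_cast; ring
      rw [this, Real.exp_zero]
      linarith [Real.exp_pos (((2 : ℕ) : ℝ) * -t)]
    have main : ∀ {w m C : ℝ}, 0 < m → m ≤ w → 1 ≤ C * (m * ((1 - 1 / H) * (τ * δ)) ^ 2) →
        0 ≤ C →
        1 ≤ C * (1 + Real.exp (2 * t)) * (w * (Real.exp (-t)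
          * ((1 - deriv φ t * Real.tan (φ t)) / √(1 + deriv φ t ^ 2))) ^ 2) := by
      intro w m C hm hw h1 hC
      calc (1 : ℝ) ≤ (C * (m * ((1 - 1 / H) * (τ * δ)) ^ 2))
            * ((1 + Real.exp (2 * t)) * Real.exp (-t) ^ 2) := one_le_mul_of_one_le_of_one_le h1 hexp
        _ = C * (1 + Real.exp (2 * t)) * (m * (Real.exp (-t) * ((1 - 1 / H) * (τ * δ))) ^ 2) := by
          ring
        _ ≤ _ := by
          have := (hm.trans_le hw).le
          gcongr
    have hA : 0 < 1 / (τ * δ * (τ * δ) * ((1 - 1 / H) * (τ * δ)) ^ 2) := by positivity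
    have hB : 0 < 1 / (τ * ((1 - 1 / H) * (τ * δ)) ^ 2) := by positivity
    constructor
    · rw [hp]
      refine main (m := τ * δ * (τ * δ)) (by positivity) ?_ ?_ (by positivity)
      · rw [div_eq_mul_one_div]
        exact mul_le_mul (mul_le_mul (hτ t) (hδ t) hδ0.le (pow_pos (hT t) _).le) (hWinv t)
          (by positivity) (mul_pos (pow_pos (hT t) _) (hcos t)).le
      · rw [add_mul, one_div_mul_cancel hm0.ne']
        linarith [mul_pos hB hm0]
    · have hm1 : 0 < τ * ((1 - 1 / H) * (τ * δ)) ^ 2 := by positivity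
      refine main (m := τ) hτ0 ?_ ?_ (by positivity)
      · rw [density_hyperbolicProfile _ hdφ hb, hk1]
        refine (hτ t).trans (le_mul_of_one_le_left (pow_pos (hT t) _).le ?_)
        rw [one_le_div (hcos t)]
        exact (Real.cos_le_one _).trans (hW1 t)
      · rw [add_mul, one_div_mul_cancel hm1.ne']
        linarith [mul_pos hA hm1]

end Hyperbolic

/-- Every unduloid has a positive Jacobi factor. -/
theorem IsDelaunayUnduloid.exists_isJacobiFactor {n : ℕ} (hn : 2 ≤ n) {c : SpaceForm} {H μ : ℝ}
    {P : Profile} (hP : IsDelaunayUnduloid n c H μ P) :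
    ∃ V ψ ψ', IsJacobiFactor n c P V ψ ψ' := by
  obtain ⟨hμ, hP, hm⟩ := hP
  cases c
  · obtain ⟨rfl, f, hf, hpos, rfl, hc⟩ := hP
    exact isJacobiFactor_euclidean hn hμ hf hpos hc hm
  · obtain ⟨hH, φ, hφ, hb, rfl, hc⟩ := hP
    exact isJacobiFactor_hyperbolic hn hH hμ hφ hb hc hm

/-! ### Polar coordinates and the divergence theorem on the sphere -/

section Sphere
variable {n : ℕ}

lemma integral_polar [NeZero n] (F : EuclideanSpace ℝ (Fin n) → ℝ) :
    ∫ x, F x = ∫ p : Metric.sphere (0 : EuclideanSpace ℝ (Fin n)) 1 × Set.Ioi (0 : ℝ),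
      F ((p.2 : ℝ) • (p.1 : EuclideanSpace ℝ (Fin n)))
      ∂((volume : Measure (EuclideanSpace ℝ (Fin n))).toSphere.prod
        (Measure.volumeIoiPow (n - 1))) := by
  have h := (volume : Measure (EuclideanSpace ℝ (Fin n))).measurePreserving_homeomorphUnitSphereProd
  have h1 := h.integral_comp (homeomorphUnitSphereProd (EuclideanSpace ℝ (Fin n))).measurableEmbedding
    (fun p => F ((p.2 : ℝ) • (p.1 : EuclideanSpace ℝ (Fin n))))
  rw [finrank_euclideanSpace_fin] at h1
  have h0 : ∫ x, F x = ∫ x : ({0}ᶜ : Set (EuclideanSpace ℝ (Fin n))), F x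
      ∂(Measure.comap Subtype.val volume) := by
    rw [integral_subtype_comap (measurableSet_singleton _).compl F, restrict_compl_singleton]
  rw [h0, ← h1]
  apply integral_congr_ae
  filter_upwards with x
  congr 1
  have h2 := congrArg Subtype.val 
    ((homeomorphUnitSphereProd (EuclideanSpace ℝ (Fin n))).symm_apply_apply x)
  rw [homeomorphUnitSphereProd_symm_apply_coe] at h2
  exact h2.symm

lemma integrable_volumeIoiPow {a : ℝ → ℝ} (ha : Continuous a) (hs : HasCompactSupport a) (m : ℕ) :
    Integrable (fun r : Set.Ioi (0 : ℝ) => a r) (Measure.volumeIoiPow m) := by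
  rw [Measure.volumeIoiPow, integrable_withDensity_iff_integrable_smul₀' (by fun_prop) (by simp)]
  have h1 : Integrable (fun r : ℝ => r ^ m * a r) :=
    ((continuous_id.pow m).mul ha).integrable_of_hasCompactSupport hs.mul_left
  have h2 := (integrableOn_iff_comap_subtypeVal measurableSet_Ioi).1
    (h1.integrableOn (s := Set.Ioi 0))
  refine h2.congr (Eventually.of_forall fun r => ?_)
  have hr : (0 : ℝ) < r := r.2
  simp [ENNReal.toReal_ofReal (pow_pos hr m).le]

lemma integral_volumeIoiPow (a : ℝ → ℝ) (m : ℕ) :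
    ∫ r : Set.Ioi (0 : ℝ), a r ∂(Measure.volumeIoiPow m) = ∫ r in Set.Ioi (0 : ℝ), r ^ m * a r := by
  simp only [Measure.volumeIoiPow]
  rw [integral_withDensity_eq_integral_toReal_smul (by fun_prop) (by simp),
    ← integral_subtype_comap measurableSet_Ioi]
  refine integral_congr_ae (Eventually.of_forall fun r => ?_)
  have hr : (0 : ℝ) < r := r.2
  simp [ENNReal.toReal_ofReal (pow_pos hr m).le]

/-- A homogeneous function of degree zero that is `C¹` away from the origin satisfies the
divergence theorem on the unit sphere for the gradient of a linear function. -/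
theorem integral_sphere_fderiv [NeZero n] {G : EuclideanSpace ℝ (Fin n) → ℝ}
    (hG : ContDiffOn ℝ 1 G {0}ᶜ) (hom : ∀ r : ℝ, 0 < r → ∀ x, G (r • x) = G x)
    (θ : EuclideanSpace ℝ (Fin n)) :
    ∫ w : Metric.sphere (0 : EuclideanSpace ℝ (Fin n)) 1, fderiv ℝ G w θ
        ∂(volume : Measure (EuclideanSpace ℝ (Fin n))).toSphere
      = (n - 1) * ∫ w : Metric.sphere (0 : EuclideanSpace ℝ (Fin n)) 1, inner ℝ θ w * G w
        ∂(volume : Measure (EuclideanSpace ℝ (Fin n))).toSphere := by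
  -- A radial cutoff vanishing off `1 < r < 3` keeps away from the origin, where `G` may be
  -- singular.
  let g : ContDiffBump (2 : ℝ) := ⟨1 / 2, 1, by norm_num, by norm_num⟩
  have hgs : ContDiff ℝ ∞ g := g.contDiff
  have hg0 : ∀ r : ℝ, r ∉ Set.Ioo (1 : ℝ) 3 → g r = 0 := fun r hr => by
    refine g.zero_of_le_dist ?_
    by_contra h
    push Not at h
    change dist r 2 < 1 at h
    rw [Real.dist_eq, abs_lt] at h
    exact hr ⟨by linarith [h.1], by linarith [h.2]⟩
  have hdg : ∀ r : ℝ, HasDerivAt g (deriv g r) r := fun r =>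
    (hgs.differentiable (by simp) r).hasDerivAt
  have hcdg : Continuous (deriv g) := hgs.continuous_deriv (by simp)
  have hg00 : ∀ᶠ r in 𝓝 (0 : ℝ), g r = 0 := by
    filter_upwards [Iio_mem_nhds (one_pos : (0 : ℝ) < 1)] with r hr
    exact hg0 r fun h => absurd h.1 (not_lt.2 (le_of_lt hr))
  -- The sphere identity is extracted from `∫ ∂_θ Φ = 0` over `ℝⁿ`. The extra factor `‖x‖` cancels
  -- the homogeneity of degree `-1` of the derivative of `G`, so each term of `∂_θ Φ` is a function
  -- on the sphere times a radial function.
  set Φ : EuclideanSpace ℝ (Fin n) → ℝ := fun x => ‖x‖ * g ‖x‖ * G x with hΦ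
  have hΦ0 : Φ =ᶠ[𝓝 0] fun _ => 0 := by
    have : Tendsto (fun x : EuclideanSpace ℝ (Fin n) => ‖x‖) (𝓝 0) (𝓝 0) := by
      simpa using (continuous_norm (E := EuclideanSpace ℝ (Fin n))).tendsto 0
    filter_upwards [this.eventually hg00] with x hx
    simp [hΦ, hx]
  have hGat : ∀ x, x ≠ 0 → ContDiffAt ℝ 1 G x := fun x hx =>
    hG.contDiffAt (isOpen_compl_singleton.mem_nhds hx)
  have hΦs : ContDiff ℝ 1 Φ := by
    rw [contDiff_iff_contDiffAt]
    intro x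
    by_cases hx : x = 0
    · subst hx
      exact (contDiffAt_const (c := (0 : ℝ))).congr_of_eventuallyEq hΦ0
    · have hn : ContDiffAt ℝ 1 (fun x : EuclideanSpace ℝ (Fin n) => ‖x‖) x := contDiffAt_norm ℝ hx
      exact (hn.mul ((hgs.of_le (by simp)).contDiffAt.comp x hn)).mul (hGat x hx)
  have hΦc : HasCompactSupport Φ := by
    refine HasCompactSupport.intro (isCompact_closedBall (0 : EuclideanSpace ℝ (Fin n)) 3)
      fun x hx => ?_
    have : ‖x‖ ∉ Set.Ioo (1 : ℝ) 3 := fun h => hx (by simpa using h.2.le)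
    simp [hΦ, hg0 _ this]
  have hzero : ∫ x, fderiv ℝ Φ x θ = 0 := by
    have hd : Continuous fun x => fderiv ℝ Φ x θ :=
      (hΦs.continuous_fderiv (by simp)).clm_apply continuous_const
    have hdc : HasCompactSupport fun x => fderiv ℝ Φ x θ :=
      hΦc.fderiv_apply (𝕜 := ℝ) θ
    have := integral_mul_fderiv_eq_neg_fderiv_mul_of_integrable (μ := volume) (𝕜 := ℝ)
      (f := Φ) (g := fun _ : EuclideanSpace ℝ (Fin n) => (1 : ℝ)) (v := θ)
      (by simpa using hd.integrable_of_hasCompactSupport hdc) (by simp)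
      (by simpa using hΦs.continuous.integrable_of_hasCompactSupport hΦc)
      (fun x _ => hΦs.differentiable (by simp) x) (fun x _ => differentiableAt_const _)
    simpa using this
  have hfG : ∀ r : ℝ, 0 < r → ∀ w : EuclideanSpace ℝ (Fin n), w ≠ 0 →
      fderiv ℝ G (r • w) θ = r⁻¹ * fderiv ℝ G w θ := by
    intro r hr w hw
    have h1 : HasFDerivAt G (fderiv ℝ G (r • w)) (r • w) :=
      ((hGat _ (smul_ne_zero hr.ne' hw)).differentiableAt (by simp)).hasFDerivAt
    have h2 := h1.comp w ((hasFDerivAt_id w).const_smul r)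
    have h3 : (G ∘ HSMul.hSMul r) = G := funext fun x => hom r hr x
    have h4 : fderiv ℝ G w θ = r * fderiv ℝ G (r • w) θ := by
      have := h2.fderiv
      rw [h3] at this
      rw [this]
      simp
    rw [h4, inv_mul_cancel_left₀ hr.ne']
  have hderiv : ∀ p : Metric.sphere (0 : EuclideanSpace ℝ (Fin n)) 1 × Set.Ioi (0 : ℝ),
      fderiv ℝ Φ ((p.2 : ℝ) • (p.1 : EuclideanSpace ℝ (Fin n))) θ
      = (inner ℝ θ (p.1 : EuclideanSpace ℝ (Fin n)) * G p.1)
          * (g (p.2 : ℝ) + p.2 * deriv g p.2) + fderiv ℝ G p.1 θ * g (p.2 : ℝ) := by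
    rintro ⟨⟨w, hw⟩, ⟨r, hr⟩⟩
    have hr : 0 < r := hr
    have hw1 : ‖w‖ = 1 := by simpa using hw
    have hw0 : w ≠ 0 := fun h => by simp [h] at hw1
    have hx0 : r • w ≠ 0 := smul_ne_zero hr.ne' hw0
    have hnr : ‖r • w‖ = r := by rw [norm_smul, hw1, mul_one, Real.norm_of_nonneg hr.le]
    have h1 := (hasStrictFDerivAt_norm_sq (r • w)).hasFDerivAt.sqrt
      (by positivity)
    have h2 : HasFDerivAt (fun x : EuclideanSpace ℝ (Fin n) => ‖x‖)
        ((1 / (2 * √(‖r • w‖ ^ 2))) • (2 • innerSL ℝ (r • w))) (r • w) := by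
      simpa only [Real.sqrt_sq (norm_nonneg _)] using h1
    have h3 := ((hdg ‖r • w‖).comp_hasFDerivAt (r • w) h2)
    have h4 := (h2.fun_mul h3).fun_mul
      ((hGat _ hx0).differentiableAt (by simp)).hasFDerivAt
    have h5 : fderiv ℝ Φ (r • w) = _ := h4.fderiv
    rw [h5]
    simp only [hnr, Function.comp_apply, add_apply, smul_apply,
      smul_eq_mul, hfG r hr w hw0, hom r hr w, innerSL_apply_apply, inner_smul_left,
      real_inner_comm θ w, Real.sqrt_sq hr.le]
    simp
    field_simp
    ring
  rw [integral_polar] at hzero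
  simp only [hderiv] at hzero
  have hcoe : Continuous fun w : Metric.sphere (0 : EuclideanSpace ℝ (Fin n)) 1 =>
    (w : EuclideanSpace ℝ (Fin n)) := continuous_subtype_val
  have hwne : ∀ w : Metric.sphere (0 : EuclideanSpace ℝ (Fin n)) 1,
      (w : EuclideanSpace ℝ (Fin n)) ∈ ({0}ᶜ : Set (EuclideanSpace ℝ (Fin n))) := fun w h => by
    have := w.2
    rw [h] at this
    simp at this
  have hcG : Continuous fun w : Metric.sphere (0 : EuclideanSpace ℝ (Fin n)) 1 =>
      G (w : EuclideanSpace ℝ (Fin n)) :=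
    hG.continuousOn.comp_continuous hcoe hwne
  have hA : Continuous fun w : Metric.sphere (0 : EuclideanSpace ℝ (Fin n)) 1 =>
      inner ℝ θ (w : EuclideanSpace ℝ (Fin n)) * G w := (continuous_const.inner hcoe).mul hcG
  have hB : Continuous fun w : Metric.sphere (0 : EuclideanSpace ℝ (Fin n)) 1 =>
      fderiv ℝ G w θ :=
    ((hG.continuousOn_fderiv_of_isOpen isOpen_compl_singleton (by simp)).comp_continuous
      hcoe hwne).clm_apply continuous_const
  have hgc : HasCompactSupport g := g.hasCompactSupport
  have ha : Continuous fun r : ℝ => g r + r * deriv g r := by fun_prop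
  have hac : HasCompactSupport fun r : ℝ => g r + r * deriv g r :=
    hgc.add (hgc.deriv.mul_left)
  rw [integral_add, integral_prod_mul (fun w : Metric.sphere (0 : EuclideanSpace ℝ (Fin n)) 1 =>
      inner ℝ θ (w : EuclideanSpace ℝ (Fin n)) * G w)
      (fun r : Set.Ioi (0 : ℝ) => g (r : ℝ) + r * deriv g r),
    integral_prod_mul (fun w : Metric.sphere (0 : EuclideanSpace ℝ (Fin n)) 1 => fderiv ℝ G w θ)
      (fun r : Set.Ioi (0 : ℝ) => g (r : ℝ)),
    integral_volumeIoiPow (fun r => g r + r * deriv g r), integral_volumeIoiPow g] at hzero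
  · have hn1 : ((n - 1 : ℕ) : ℝ) = n - 1 := by
      rw [Nat.cast_sub (NeZero.one_le), Nat.cast_one]
    have hIoi : ∀ f : ℝ → ℝ, (∀ r, r ∉ Set.Ioo (1 : ℝ) 3 → f r = 0) →
        ∫ r in Set.Ioi (0 : ℝ), f r = ∫ r, f r := fun f hf =>
      setIntegral_eq_integral_of_forall_compl_eq_zero fun r hr =>
        hf r fun h => hr (lt_trans one_pos h.1)
    have hi1 : Integrable fun r : ℝ => r ^ (n - 1) * g r :=
      ((continuous_id.pow _).mul g.continuous).integrable_of_hasCompactSupport hgc.mul_left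
    have hi2 : Integrable fun r : ℝ => r ^ (n - 1) * (g r + r * deriv g r) :=
      ((continuous_id.pow _).mul ha).integrable_of_hasCompactSupport hac.mul_left
    have hi3 : Integrable fun r : ℝ => r ^ n * g r :=
      ((continuous_id.pow _).mul g.continuous).integrable_of_hasCompactSupport hgc.mul_left
    -- As `g + r g' = (r g)'`, integrating by parts against `r ^ (n - 1)` produces the eigenvalue `n
    -- - 1`.
    have hint : ∫ r in Set.Ioi (0 : ℝ), r ^ (n - 1) * (g r + r * deriv g r)
        = -(n - 1) * ∫ r in Set.Ioi (0 : ℝ), r ^ (n - 1) * g r := by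
      have hdz : ∀ r, r ∉ Set.Ioo (1 : ℝ) 3 → g r + r * deriv g r = 0 := by
        intro r hr
        have h1 : IsLocalMin g r := Eventually.of_forall fun y => by
          rw [hg0 r hr]; exact g.nonneg
        rw [hg0 r hr, h1.deriv_eq_zero]; simp
      rw [hIoi _ fun r hr => by rw [hdz r hr, mul_zero], hIoi _ fun r hr => by
        rw [hg0 r hr, mul_zero]]
      have hdd : ∀ r, HasDerivAt (fun r : ℝ => r ^ n * g r)
          ((n - 1) * (r ^ (n - 1) * g r) + r ^ (n - 1) * (g r + r * deriv g r)) r := by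
        intro r
        refine ((hasDerivAt_pow n r).fun_mul (hdg r)).congr_deriv ?_
        have : r ^ n = r ^ (n - 1) * r := by
          rw [← pow_succ, Nat.sub_add_cancel NeZero.one_le]
        rw [this]
        ring
      have h0 := integral_eq_zero_of_hasDerivAt_of_integrable hdd
        ((hi1.const_mul _).add hi2) hi3
      rw [integral_add (hi1.const_mul _) hi2, integral_const_mul] at h0
      linarith
    have hpos : 0 < ∫ r in Set.Ioi (0 : ℝ), r ^ (n - 1) * g r := by
      rw [hIoi _ fun r hr => by rw [hg0 r hr, mul_zero]]
      refine integral_pos_of_integrable_nonneg_nonzero (x := 2)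
        ((continuous_id.pow _).mul g.continuous) hi1 ?_ ?_
      · intro r
        by_cases hr : r ∈ Set.Ioo (1 : ℝ) 3
        · exact mul_nonneg (pow_nonneg (by linarith [hr.1]) _) g.nonneg
        · simp [hg0 r hr]
      · have : g 2 = 1 := g.one_of_mem_closedBall (Metric.mem_closedBall_self g.rIn_pos.le)
        simp [this]
    rw [hint] at hzero
    refine mul_right_cancel₀ hpos.ne' ?_
    linear_combination hzero
  · exact (hA.integrable_of_hasCompactSupport (HasCompactSupport.of_compactSpace _)).mul_prod
      (integrable_volumeIoiPow ha hac _)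
  · exact (hB.integrable_of_hasCompactSupport (HasCompactSupport.of_compactSpace _)).mul_prod
      (integrable_volumeIoiPow g.continuous hgc _)

end Sphere

/-! ### Extension along rays, and supports in the half-space -/

section Lift
variable {n : ℕ}

/-- The retraction of `ℝ × (ℝⁿ ∖ 0)` onto `ℝ × Sⁿ⁻¹`. -/
def retract (q : Amb n) : Amb n := (q.1, ‖q.2‖⁻¹ • q.2)

lemma retract_incl (p : Cyl n) : retract p.incl = p.incl := by
  have : ‖p.incl.2‖ = 1 := by simp [Cyl.incl]
  simp [retract, this]

lemma incl_snd_ne_zero (p : Cyl n) : p.incl.2 ≠ 0 := fun h => by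
  have := inner_incl_self p
  rw [h, inner_zero_left] at this
  exact one_ne_zero this.symm

lemma continuous_incl : Continuous (Cyl.incl : Cyl n → Amb n) :=
  continuous_fst.prodMk (continuous_subtype_val.comp continuous_snd)

lemma exists_incl_eq_retract {q : Amb n} (hq : q.2 ≠ 0) : ∃ p : Cyl n, p.incl = retract q :=
  ⟨(q.1, ⟨‖q.2‖⁻¹ • q.2, by simp [norm_smul, hq]⟩), rfl⟩

lemma contDiffAt_retract {q : Amb n} (hq : q.2 ≠ 0) :
    ContDiffAt ℝ ∞ (retract : Amb n → Amb n) q := by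
  have h : ContDiffAt ℝ ∞ (fun q : Amb n => ‖q.2‖) q :=
    (contDiffAt_norm ℝ hq).comp q contDiffAt_snd
  exact contDiffAt_fst.prodMk ((h.inv (norm_ne_zero_iff.2 hq)).smul contDiffAt_snd)

lemma hasFDerivAt_retract (p : Cyl n) :
    ∃ A : Amb n →L[ℝ] Amb n, HasFDerivAt (retract : Amb n → Amb n) A p.incl ∧
      ∀ v, A v = (v.1, tang p.incl.2 v.2) := by
  have hn : ‖p.incl.2‖ = 1 := by simp [Cyl.incl]
  have h1 : HasFDerivAt (fun q : Amb n => √(‖q.2‖ ^ 2)) _ p.incl :=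
    (((hasStrictFDerivAt_norm_sq p.incl.2).hasFDerivAt.sqrt
      (by rw [hn]; norm_num)).comp p.incl hasFDerivAt_snd)
  simp only [Real.sqrt_sq (norm_nonneg _)] at h1
  have h2 := ((hasDerivAt_inv (by rw [hn]; norm_num : ‖p.incl.2‖ ≠ 0)).comp_hasFDerivAt p.incl
    h1).smul (hasFDerivAt_snd (𝕜 := ℝ) (p := p.incl))
  refine ⟨_, (hasFDerivAt_fst (p := p.incl)).prodMk h2, fun v => ?_⟩
  simp [hn, tang, sub_eq_add_neg]

/-- The extension of the restriction of a function to `ℝ × Sⁿ⁻¹` that is constant along rays. -/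
def lift (U : Amb n → ℝ) (q : Amb n) : ℝ := U (retract q)

variable {U : Amb n → ℝ}

lemma lift_incl (p : Cyl n) : lift U p.incl = U p.incl := by rw [lift, retract_incl]

lemma contDiffAt_lift (hU : ContDiff ℝ ∞ U) {q : Amb n} (hq : q.2 ≠ 0) :
    ContDiffAt ℝ ∞ (lift U) q :=
  hU.contDiffAt.comp q (contDiffAt_retract hq)

lemma lift_smul {r : ℝ} (hr : 0 < r) (t : ℝ) (x : EuclideanSpace ℝ (Fin n)) :
    lift U (t, r • x) = lift U (t, x) := by
  simp only [lift, retract, norm_smul, Real.norm_of_nonneg hr.le, smul_smul]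
  congr 3
  field_simp

lemma fderiv_lift (hU : ContDiff ℝ ∞ U) (p : Cyl n) (v : Amb n) :
    fderiv ℝ (lift U) p.incl v = fderiv ℝ U p.incl (v.1, tang p.incl.2 v.2) := by
  obtain ⟨A, hA, hAv⟩ := hasFDerivAt_retract p
  have h1 : HasFDerivAt U (fderiv ℝ U p.incl) (retract p.incl) := by
    rw [retract_incl]
    exact (hU.differentiable (by simp) _).hasFDerivAt
  have h2 : fderiv ℝ (lift U) p.incl = _ := (h1.comp p.incl hA).fderiv
  rw [h2]
  simp [hAv]

lemma fderiv_lift_normal (hU : ContDiff ℝ ∞ U) (p : Cyl n) :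
    fderiv ℝ (lift U) p.incl (0, p.incl.2) = 0 := by
  rw [fderiv_lift hU, tang, inner_incl_self]
  have : ((0 : ℝ), p.incl.2 - (1 : ℝ) • p.incl.2) = (0 : Amb n) := by simp
  exact (congrArg _ this).trans (map_zero _)

lemma continuous_fderiv_lift (hU : ContDiff ℝ ∞ U) :
    Continuous fun p : Cyl n => fderiv ℝ (lift U) p.incl := by
  refine continuous_iff_continuousAt.2 fun p => ?_
  have : ContDiffAt ℝ 1 (lift U) p.incl :=
    (contDiffAt_lift hU (incl_snd_ne_zero p)).of_le (by simp)
  exact ContinuousAt.comp (f := fun p : Cyl n => p.incl)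
    (this.continuousAt_fderiv (by simp)) continuous_incl.continuousAt

/-- Compactness makes the image of the support closed in the ambient space, so the retraction, being
continuous at `q`, avoids it near `q`. -/
lemma lift_eventuallyEq_zero (hc : HasCompactSupport fun p : Cyl n => U p.incl) {q : Amb n}
    (hq : q.2 ≠ 0) (h : ∀ p ∈ tsupport (fun p : Cyl n => U p.incl), p.incl ≠ retract q) :
    lift U =ᶠ[𝓝 q] fun _ => 0 := by
  have hK : IsClosed (Cyl.incl '' tsupport (fun p : Cyl n => U p.incl)) :=
    (hc.isCompact.image continuous_incl).isClosed
  have h1 : retract q ∉ Cyl.incl '' tsupport (fun p : Cyl n => U p.incl) := by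
    rintro ⟨p, hp, hpq⟩
    exact h p hp hpq
  filter_upwards [(contDiffAt_retract hq).continuousAt.eventually (hK.isOpen_compl.mem_nhds h1),
    continuousAt_snd.eventually_ne hq] with q' hq' hq'0
  obtain ⟨p, hp⟩ := exists_incl_eq_retract hq'0
  have : p ∉ tsupport (fun p : Cyl n => U p.incl) := fun hps => hq' ⟨p, hps, hp⟩
  rw [lift, ← hp]
  exact image_eq_zero_of_notMem_tsupport (f := fun p : Cyl n => U p.incl) this

lemma incl_injective : Function.Injective (Cyl.incl : Cyl n → Amb n) := by
  rintro ⟨t, w⟩ ⟨t', w'⟩ h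
  have h1 := congrArg Prod.fst h
  have h2 := congrArg Prod.snd h
  exact Prod.ext h1 (Subtype.ext h2)

lemma lift_eventuallyEq_zero_incl (hc : HasCompactSupport fun p : Cyl n => U p.incl) {p : Cyl n}
    (hp : p ∉ tsupport (fun p : Cyl n => U p.incl)) : lift U =ᶠ[𝓝 p.incl] fun _ => 0 :=
  lift_eventuallyEq_zero hc (incl_snd_ne_zero p) fun p' hp' h => hp (by
    rw [retract_incl] at h
    rwa [← incl_injective h])

lemma fderiv_lift_eq_zero (hc : HasCompactSupport fun p : Cyl n => U p.incl) {p : Cyl n}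
    (hp : p ∉ tsupport (fun p : Cyl n => U p.incl)) : fderiv ℝ (lift U) p.incl = 0 := by
  rw [(lift_eventuallyEq_zero_incl hc hp).fderiv_eq]
  simp

/-- The interior of a piece of the half-space lies in the open half-space. -/
lemma interior_subset_halfSpace {c : SpaceForm} {P : Profile} (hP : P.Regular c)
    {θ : EuclideanSpace ℝ (Fin n)} (hθ : θ ≠ 0) {Ω : Set (Amb n)} (hΩ : Ω ⊆ halfSpace θ)
    {p : Cyl n} (hp : p ∈ interior {p : Cyl n | P.param p.incl ∈ Ω}) :
    0 < inner ℝ θ p.incl.2 := by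
  have hmem : ∀ p ∈ interior {p : Cyl n | P.param p.incl ∈ Ω}, 0 ≤ inner ℝ θ p.incl.2 := by
    intro p hp
    have h0 : p ∈ {p : Cyl n | P.param p.incl ∈ Ω} := interior_subset hp
    have h1 := hΩ h0
    have h2 : 0 ≤ inner ℝ θ (P.radial p.1 • p.incl.2) := h1
    rw [inner_smul_right] at h2
    exact nonneg_of_mul_nonneg_right h2 (hP.radial_pos p.1)
  refine lt_of_le_of_ne (hmem p hp) fun h0 => ?_
  have h0 : inner ℝ θ p.incl.2 = 0 := h0.symm
  have hne : ∀ s : ℝ, p.incl.2 - s • θ ≠ 0 := by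
    intro s hs
    have := congrArg (fun v => inner ℝ v p.incl.2) hs
    simp only [inner_sub_left, inner_smul_left, h0, inner_incl_self, inner_zero_left] at this
    simp at this
  -- From a point of the equator, moving in the direction `-θ` leaves the half-space at once, so
  -- such a point is not interior.
  let γ : ℝ → Cyl n := fun s => (p.1, ⟨‖p.incl.2 - s • θ‖⁻¹ • (p.incl.2 - s • θ), by
    simp [norm_smul, hne s]⟩)
  have hγ : Continuous γ := by
    refine continuous_const.prodMk (Continuous.subtype_mk ?_ _)
    have h1 : Continuous fun s : ℝ => p.incl.2 - s • θ := by fun_prop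
    exact (h1.norm.inv₀ fun s => norm_ne_zero_iff.2 (hne s)).smul h1
  have hγ0 : γ 0 = p := by
    refine incl_injective ?_
    have : ‖p.incl.2‖ = 1 := by simp [Cyl.incl]
    simp only [γ, Cyl.incl] at this ⊢
    simp [this]
  have hev : ∀ᶠ s in 𝓝 (0 : ℝ), γ s ∈ interior {p : Cyl n | P.param p.incl ∈ Ω} :=
    hγ.continuousAt.eventually (isOpen_interior.mem_nhds (by rwa [hγ0]))
  obtain ⟨s, hs, hs0⟩ := ((hev.filter_mono nhdsWithin_le_nhds).and
    (self_mem_nhdsWithin (a := (0 : ℝ)) (s := Set.Ioi 0))).exists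
  have hs0 : 0 < s := hs0
  have h1 := hmem _ hs
  have h2 : (γ s).incl.2 = ‖p.incl.2 - s • θ‖⁻¹ • (p.incl.2 - s • θ) := rfl
  rw [h2, inner_smul_right, inner_sub_right, inner_smul_right, h0, real_inner_self_eq_norm_sq] at h1
  have h3 : 0 < ‖p.incl.2 - s • θ‖⁻¹ := inv_pos.2 (norm_pos_iff.2 (hne s))
  have h4 : 0 < s * ‖θ‖ ^ 2 := mul_pos hs0 (pow_pos (norm_pos_iff.2 hθ) 2)
  nlinarith

end Lift

/-! ### Picone's inequality on the hemisphere -/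

section Hemisphere
variable {n : ℕ}

/-- A lower bound for the squared norm of the spherical part of the differential, whose integral
over a sphere is computed by the divergence theorem. -/
def picone (θ : EuclideanSpace ℝ (Fin n)) (U : Amb n → ℝ) (p : Cyl n) : ℝ :=
  2 * (U p.incl / inner ℝ θ p.incl.2) * fderiv ℝ (lift U) p.incl (0, θ)
    - (U p.incl / inner ℝ θ p.incl.2) ^ 2 * (‖θ‖ ^ 2 - inner ℝ θ p.incl.2 ^ 2)

variable {U : Amb n → ℝ} {θ : EuclideanSpace ℝ (Fin n)}

/-- Expand `|∇u - (u / ⟨θ, ω⟩) θᵀ|² ≥ 0`, with `θᵀ` the tangential part of `θ`, which is the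
spherical gradient of `⟨θ, ω⟩`. The spherical gradient of `lift U` is orthogonal to `ω`, so pairing
it with `θᵀ` or with `θ` is the same. -/
lemma picone_le (hU : ContDiff ℝ ∞ U) (p : Cyl n) :
    picone θ U p ≤ ∑ j, fderiv ℝ (lift U) p.incl (0, EuclideanSpace.basisFun (Fin n) ℝ j) ^ 2 := by
  set d := fderiv ℝ (lift U) p.incl with hd
  set a := U p.incl / inner ℝ θ p.incl.2 with ha
  have hdω : d (0, p.incl.2) = 0 := fderiv_lift_normal hU p
  let l : EuclideanSpace ℝ (Fin n) →L[ℝ] ℝ :=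
    d.comp (ContinuousLinearMap.inr ℝ ℝ (EuclideanSpace ℝ (Fin n)))
  have hl : ∀ v, d (0, v) = l v := fun v => by simp [l]
  let g := (InnerProductSpace.toDual ℝ (EuclideanSpace ℝ (Fin n))).symm l
  have hg : ∀ v, l v = inner ℝ g v := fun v =>
    (InnerProductSpace.toDual_symm_apply (x := v) (y := l)).symm
  have h1 := (EuclideanSpace.basisFun (Fin n) ℝ).sum_sq_norm_inner_left g
  simp only [Real.norm_eq_abs, sq_abs] at h1
  simp only [hl, hg] at hdω ⊢
  rw [h1]
  have h2 : 0 ≤ ‖g - a • tang p.incl.2 θ‖ ^ 2 := by positivity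
  have h3 := inner_incl_self p
  rw [← real_inner_self_eq_norm_sq] at h2 ⊢
  simp only [tang, inner_sub_left, inner_sub_right, inner_smul_left, inner_smul_right, h3,
    real_inner_comm g, hdω, real_inner_comm θ p.incl.2] at h2
  simp only [picone, ← hd, ← ha, hl, hg]
  rw [← real_inner_self_eq_norm_sq θ]
  simp only [conj_trivial] at h2
  nlinarith

lemma picone_eq_zero {p : Cyl n}
    (hp : p ∉ tsupport (fun p : Cyl n => U p.incl)) : picone θ U p = 0 := by
  have h0 : U p.incl = 0 :=
    image_eq_zero_of_notMem_tsupport (f := fun p : Cyl n => U p.incl) hp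
  simp [picone, h0]

/-- The denominator `⟨θ, ω⟩` is positive on the support, and near any point off the support the
function is identically zero, the equator included. -/
lemma continuous_picone (hU : ContDiff ℝ ∞ U)
    (hs : ∀ p ∈ tsupport (fun p : Cyl n => U p.incl), 0 < inner ℝ θ p.incl.2) :
    Continuous (picone θ U) := by
  refine continuous_iff_continuousAt.2 fun p => ?_
  by_cases hp : p ∈ tsupport (fun p : Cyl n => U p.incl)
  · have h1 : ContinuousAt (fun p : Cyl n => inner ℝ θ p.incl.2) p :=
      (continuous_const.inner (continuous_snd.comp continuous_incl)).continuousAt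
    have h2 : ContinuousAt (fun p : Cyl n => U p.incl) p :=
      (hU.continuous.comp continuous_incl).continuousAt
    have h3 : ContinuousAt (fun p : Cyl n => fderiv ℝ (lift U) p.incl (0, θ)) p :=
      ((continuous_fderiv_lift hU).clm_apply continuous_const).continuousAt
    have h4 := h2.div h1 (hs p hp).ne'
    exact ((continuousAt_const.mul h4).mul h3).sub
      ((h4.pow 2).mul (continuousAt_const.sub (h1.pow 2)))
  · have : picone θ U =ᶠ[𝓝 p] fun _ => 0 := by
      filter_upwards [(isClosed_tsupport _).isOpen_compl.mem_nhds hp] with p' hp'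
      exact picone_eq_zero hp'
    exact continuousAt_const.congr this.symm

/-- Test functions on the half-sphere satisfy the sharp Poincaré inequality; in divergence form. -/
theorem integral_picone [NeZero n] (hU : ContDiff ℝ ∞ U)
    (hc : HasCompactSupport fun p : Cyl n => U p.incl)
    (hs : ∀ p ∈ tsupport (fun p : Cyl n => U p.incl), 0 < inner ℝ θ p.incl.2) (t : ℝ) :
    ∫ w, picone θ U (t, w) ∂(volume : Measure (EuclideanSpace ℝ (Fin n))).toSphere
      = (n - 1) * ∫ w, U (Cyl.incl (t, w)) ^ 2
        ∂(volume : Measure (EuclideanSpace ℝ (Fin n))).toSphere := by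
  -- This is `u² / ⟨θ, ω⟩`, extended with degree zero. Its derivative along `θ` is `picone`, and
  -- `⟨θ, ω⟩ G = u²`, so the divergence theorem on the sphere gives the claim.
  let G : EuclideanSpace ℝ (Fin n) → ℝ := fun x =>
    lift U (t, x) ^ 2 * (inner ℝ θ (‖x‖⁻¹ • x))⁻¹
  have hpt : ∀ p : Cyl n, p.1 = t → p ∉ tsupport (fun p : Cyl n => U p.incl) →
      ∀ x : EuclideanSpace ℝ (Fin n), x ≠ 0 → p.incl = retract (t, x) →
      G =ᶠ[𝓝 x] fun _ => 0 := by
    intro p hp1 hp x hx hpx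
    have h1 := lift_eventuallyEq_zero hc (q := (t, x)) hx fun p' hp' h =>
      hp (by rwa [← incl_injective (h.trans hpx.symm)])
    have h2 : Continuous fun x : EuclideanSpace ℝ (Fin n) => ((t, x) : Amb n) := by fun_prop
    filter_upwards [h2.continuousAt.eventually h1] with y hy
    simp [G, hy]
  have hGat : ∀ x : EuclideanSpace ℝ (Fin n), x ≠ 0 → ContDiffAt ℝ 1 G x := by
    intro x hx
    obtain ⟨p, hp⟩ := exists_incl_eq_retract (q := ((t, x) : Amb n)) hx
    have hp1 : p.1 = t := congrArg Prod.fst hp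
    by_cases hps : p ∈ tsupport (fun p : Cyl n => U p.incl)
    · have h1 : ContDiffAt ℝ 1 (fun x : EuclideanSpace ℝ (Fin n) => lift U (t, x)) x :=
        ((contDiffAt_lift hU (q := ((t, x) : Amb n)) hx).of_le (by simp)).comp x
          (contDiffAt_const.prodMk contDiffAt_id)
      have h2 : ContDiffAt ℝ 1 (fun x : EuclideanSpace ℝ (Fin n) => inner ℝ θ (‖x‖⁻¹ • x)) x :=
        contDiffAt_const.inner ℝ
          (((contDiffAt_norm ℝ hx).inv (norm_ne_zero_iff.2 hx)).smul contDiffAt_id)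
      have h3 := hs p hps
      rw [hp] at h3
      exact (h1.pow 2).mul (h2.inv h3.ne')
    · exact (contDiffAt_const (c := (0 : ℝ))).congr_of_eventuallyEq (hpt p hp1 hps x hx hp)
  have key := integral_sphere_fderiv (G := G) (fun x hx => (hGat x hx).contDiffWithinAt)
    (fun r hr x => by
      simp only [G, lift_smul hr, norm_smul, Real.norm_of_nonneg hr.le, smul_smul]
      congr 3
      field_simp) θ
  have hfd : ∀ w : Metric.sphere (0 : EuclideanSpace ℝ (Fin n)) 1,
      fderiv ℝ G w θ = picone θ U (t, w) := by
    intro w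
    have hw0 := incl_snd_ne_zero ((t, w) : Cyl n)
    by_cases hps : (t, w) ∈ tsupport (fun p : Cyl n => U p.incl)
    · have h1 : HasFDerivAt (fun x : EuclideanSpace ℝ (Fin n) => lift U (t, x))
          ((fderiv ℝ (lift U) (Cyl.incl (t, w))).comp
            (ContinuousLinearMap.inr ℝ ℝ (EuclideanSpace ℝ (Fin n)))) w := by
        have h := ((contDiffAt_lift hU hw0).differentiableAt (by simp)).hasFDerivAt
        exact HasFDerivAt.comp (f := fun x : EuclideanSpace ℝ (Fin n) => ((t, x) : Amb n))
          (w : EuclideanSpace ℝ (Fin n)) h (hasFDerivAt_prodMk_right t _)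
      obtain ⟨A, hA, hAv⟩ := hasFDerivAt_retract ((t, w) : Cyl n)
      have h2 : HasFDerivAt (fun x : EuclideanSpace ℝ (Fin n) =>
          inner ℝ θ (retract ((t, x) : Amb n)).2) ((innerSL ℝ θ).comp
            ((ContinuousLinearMap.snd ℝ ℝ (EuclideanSpace ℝ (Fin n))).comp
              (A.comp (ContinuousLinearMap.inr ℝ ℝ (EuclideanSpace ℝ (Fin n)))))) w :=
        (innerSL ℝ θ).hasFDerivAt.comp (w : EuclideanSpace ℝ (Fin n))
          (hasFDerivAt_snd.comp (w : EuclideanSpace ℝ (Fin n))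
          (HasFDerivAt.comp (f := fun x : EuclideanSpace ℝ (Fin n) => ((t, x) : Amb n))
            (w : EuclideanSpace ℝ (Fin n)) hA (hasFDerivAt_prodMk_right t _)))
      have h3 : 0 < inner ℝ θ (Cyl.incl (t, w)).2 := hs _ hps
      have h4 : (retract ((t, w) : Amb n)).2 = (Cyl.incl (t, w)).2 :=
        congrArg Prod.snd (retract_incl ((t, w) : Cyl n))
      have h5 : lift U ((t, w) : Amb n) = U (Cyl.incl (t, w)) := lift_incl ((t, w) : Cyl n)
      have h6 : HasFDerivAt G _ (w : EuclideanSpace ℝ (Fin n)) :=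
        (h1.pow 2).mul ((hasDerivAt_inv (h4 ▸ h3.ne' : inner ℝ θ (retract ((t, w) : Amb n)).2 ≠ 0)).comp_hasFDerivAt
          (w : EuclideanSpace ℝ (Fin n)) h2)
      have h7 : ‖(w : EuclideanSpace ℝ (Fin n))‖⁻¹ • (w : EuclideanSpace ℝ (Fin n))
        = (Cyl.incl (t, w)).2 := h4
      have h8 := real_inner_self_eq_norm_sq θ
      rw [h6.fderiv, h4, h5, h7]
      simp only [picone, add_apply, smul_apply, ContinuousLinearMap.comp_apply,
        ContinuousLinearMap.inr_apply, hAv, ContinuousLinearMap.coe_snd', innerSL_apply_apply, tang,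
        inner_sub_right, inner_smul_right, h8, real_inner_comm θ (Cyl.incl (t, w)).2, smul_eq_mul]
      generalize fderiv ℝ (lift U) (Cyl.incl (t, w)) (0, θ) = z at *
      field_simp
      simp
      ring
    · have h1 : fderiv ℝ G (w : EuclideanSpace ℝ (Fin n)) = fderiv ℝ (fun _ => 0)
          (w : EuclideanSpace ℝ (Fin n)) :=
        (hpt (t, w) rfl hps _ hw0 (retract_incl _).symm).fderiv_eq
      rw [h1, picone_eq_zero hps]
      simp
  simp only [hfd] at key
  rw [key]
  congr 1
  refine integral_congr_ae (Eventually.of_forall fun w => ?_)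
  change inner ℝ θ (w : EuclideanSpace ℝ (Fin n))
    * (lift U (Cyl.incl (t, w)) ^ 2 * (inner ℝ θ (retract (Cyl.incl (t, w))).2)⁻¹) = _
  rw [retract_incl, lift_incl, ← div_eq_mul_inv]
  change inner ℝ θ (Cyl.incl (t, w)).2 * _ = U (Cyl.incl (t, w)) ^ 2
  by_cases hps : (t, w) ∈ tsupport (fun p : Cyl n => U p.incl)
  · exact mul_div_cancel₀ _ (hs _ hps).ne'
  · have h0 : U (Cyl.incl (t, w)) = 0 :=
      image_eq_zero_of_notMem_tsupport (f := fun p : Cyl n => U p.incl) hps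
    simp [h0]

end Hemisphere

/-- The product measure on `ℝ × Sⁿ⁻¹`. -/
abbrev cylVolume (n : ℕ) : Measure (Cyl n) :=
  (volume : Measure ℝ).prod (volume : Measure (EuclideanSpace ℝ (Fin n))).toSphere

/-! ### The area measure in product coordinates -/

section Regular
variable {n : ℕ} {c : SpaceForm} {P : Profile}

lemma Profile.Regular.continuous_scale (h : P.Regular c) :
    Continuous fun t => c.scale (P.axial t) :=
  c.continuous_scale.comp h.axial.continuous

lemma Profile.Regular.continuous_coeffAxial (h : P.Regular c) :
    Continuous (P.coeffAxial c) :=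
  ((h.differentiable_deriv_axial.continuous.pow 2).add
    (h.differentiable_deriv_radial.continuous.pow 2)).div (h.continuous_scale.pow 2)
    fun t => (pow_pos (h.scale_pos t) 2).ne'

lemma Profile.Regular.continuous_coeffSphere (h : P.Regular c) :
    Continuous (P.coeffSphere c) :=
  (h.radial.continuous.pow 2).div (h.continuous_scale.pow 2)
    fun t => (pow_pos (h.scale_pos t) 2).ne'

lemma Profile.Regular.continuous_density (h : P.Regular c) : Continuous (P.density n c) :=
  (h.continuous_coeffAxial.mul (h.continuous_coeffSphere.pow _)).sqrt

lemma Profile.Regular.density_pos (h : P.Regular c) (t : ℝ) : 0 < P.density n c t :=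
  Real.sqrt_pos.2 (mul_pos (h.coeffAxial_pos t) (pow_pos (h.coeffSphere_pos t) _))

lemma Profile.Regular.area_eq (h : P.Regular c) :
    area n c P = (cylVolume n).withDensity fun p => ENNReal.ofReal (P.density n c p.1) := by
  rw [area]
  congr 1
  funext p
  rw [h.det_gram, Profile.density]

lemma Profile.Regular.integral_area (h : P.Regular c) (f : Cyl n → ℝ) :
    ∫ p, f p ∂(area n c P) = ∫ p, P.density n c p.1 * f p ∂(cylVolume n) := by
  have hm : Measurable fun p : Cyl n => P.density n c p.1 :=
    (h.continuous_density.comp continuous_fst).measurable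
  rw [h.area_eq, integral_withDensity_eq_integral_toReal_smul hm.ennreal_ofReal (by simp)]
  simp [ENNReal.toReal_ofReal (h.density_pos _).le]

lemma Profile.Regular.integrable_area {f : Cyl n → ℝ} (h : P.Regular c) (hf : Continuous f)
    (hc : HasCompactSupport f) : Integrable f (area n c P) := by
  have hm : Continuous fun p : Cyl n => P.density n c p.1 :=
    h.continuous_density.comp continuous_fst
  rw [h.area_eq, integrable_withDensity_iff_integrable_smul₀'
    hm.measurable.ennreal_ofReal.aemeasurable (by simp)]
  simp only [ENNReal.toReal_ofReal (h.density_pos _).le, smul_eq_mul]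
  exact (hm.mul hf).integrable_of_hasCompactSupport hc.mul_left

lemma Profile.Regular.covectorNormSq_fderiv (h : P.Regular c) {U : Amb n → ℝ}
    (hU : ContDiff ℝ ∞ U) (p : Cyl n) :
    covectorNormSq c P p (fderiv ℝ U p.incl)
      = fderiv ℝ (lift U) p.incl (1, 0) ^ 2 / P.coeffAxial c p.1
      + (∑ j, fderiv ℝ (lift U) p.incl (0, EuclideanSpace.basisFun (Fin n) ℝ j) ^ 2)
        / P.coeffSphere c p.1 := by
  rw [h.covectorNormSq_eq]
  simp only [fderiv_lift hU]
  simp [tang]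

end Regular

/-! ### The weighted lower bound for test functions -/

/-- Picone's inequality along the profile curve, perturbed by a multiple of `B`. -/
lemma axial_picone {p D u u' ψ ψ' q B B' C ε : ℝ} (hψ : 0 < ψ) (hC : 0 < C)
    (h1 : B ≤ C * (p * ψ ^ 2)) (h2 : B ≤ C * (D * ψ ^ 2)) (hB : 0 ≤ B) :
    (ε * (B' / (C * ψ ^ 2)) - ε ^ 2 * D) * u ^ 2
      + (((q * ψ * ψ - p * ψ' * ψ') / ψ ^ 2
          - ε / C * ((B' * ψ ^ 2 - -B * (2 * ψ * ψ')) / (ψ ^ 2) ^ 2)) * u ^ 2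
        + (p * ψ' / ψ - ε / C * (-B / ψ ^ 2)) * (2 * u * u'))
      ≤ p * u' ^ 2 + q * u ^ 2 := by
  have hβ1 : B / (C * ψ ^ 2) ≤ p := by
    rw [div_le_iff₀ (by positivity)]; linarith
  have hβ2 : B / (C * ψ ^ 2) ≤ D := by
    rw [div_le_iff₀ (by positivity)]; linarith
  have hβ0 : 0 ≤ B / (C * ψ ^ 2) := by positivity
  -- The deficit is a sum of squares weighted by `p - β`, `D - β` and `β`, where `β = B / (C ψ²)`.
  -- The last square, `(u' - ψ' u / ψ - ε u)²`, equals `ψ² (v' - ε v)²` for `v = u / ψ`.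
  have key : p * u' ^ 2 + q * u ^ 2 - ((ε * (B' / (C * ψ ^ 2)) - ε ^ 2 * D) * u ^ 2
      + (((q * ψ * ψ - p * ψ' * ψ') / ψ ^ 2
          - ε / C * ((B' * ψ ^ 2 - -B * (2 * ψ * ψ')) / (ψ ^ 2) ^ 2)) * u ^ 2
        + (p * ψ' / ψ - ε / C * (-B / ψ ^ 2)) * (2 * u * u')))
      = (p - B / (C * ψ ^ 2)) * (u' - ψ' * u / ψ) ^ 2 + (D - B / (C * ψ ^ 2)) * (ε * u) ^ 2
        + B / (C * ψ ^ 2) * (u' - ψ' * u / ψ - ε * u) ^ 2 := by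
    field_simp
    ring
  have := mul_nonneg (sub_nonneg.2 hβ1) (sq_nonneg (u' - ψ' * u / ψ))
  have := mul_nonneg (sub_nonneg.2 hβ2) (sq_nonneg (ε * u))
  have := mul_nonneg hβ0 (sq_nonneg (u' - ψ' * u / ψ - ε * u))
  linarith

/-- Integrating a total derivative in the axial direction gives zero. -/
lemma integral_axial_deriv_eq_zero {n : ℕ} {f g : Cyl n → ℝ} (hf : Continuous f)
    (hg : Continuous g) (hcf : HasCompactSupport f) (hcg : HasCompactSupport g)
    (hd : ∀ p : Cyl n, HasDerivAt (fun t => f (t, p.2)) (g p) p.1) :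
    ∫ p, g p ∂(cylVolume n) = 0 := by
  have hslice : ∀ {h : Cyl n → ℝ}, Continuous h → HasCompactSupport h → ∀ w,
      Integrable fun t => h (t, w) := fun {h} hh hc w => by
    have h1 : Continuous fun t : ℝ => h (t, w) := hh.comp (by fun_prop)
    refine h1.integrable_of_hasCompactSupport
      (HasCompactSupport.intro (hc.isCompact.image continuous_fst) fun t ht => ?_)
    exact image_eq_zero_of_notMem_tsupport fun h' => ht ⟨_, h', rfl⟩
  rw [integral_prod_symm _ (hg.integrable_of_hasCompactSupport hcg)]
  have : ∀ w, ∫ t, g (t, w) = 0 := fun w =>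
    integral_eq_zero_of_hasDerivAt_of_integrable (fun t => hd (t, w)) (hslice hg hcg w)
      (hslice hf hcf w)
  simp [this]

/-- The stability form of a test function on the half-unduloid controls a weighted `L²` norm, up
to a lower order error. -/
theorem IsJacobiFactor.exists_weight {n : ℕ} [NeZero n] {c : SpaceForm} {P : Profile}
    {V ψ ψ' : ℝ → ℝ} (J : IsJacobiFactor n c P V ψ ψ') :
    ∃ ρ : ℝ → ℝ, Continuous ρ ∧ (∀ t, 0 < ρ t) ∧ (∀ t, ρ t ≤ 2) ∧
      ∀ ε : ℝ, ∀ θ : EuclideanSpace ℝ (Fin n), θ ≠ 0 → ∀ Ω ⊆ halfSpace θ,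
      ∀ U, IsTest P Ω U → ∫ p, (ε * ρ p.1 - ε ^ 2) * U p.incl ^ 2 ∂(area n c P)
        ≤ stabilityForm c P (fun p => U p.incl) (fun p => fderiv ℝ U p.incl) := by
  obtain ⟨C, hC, hgrow⟩ := J.growth
  have hR := J.regular
  set D := P.density n c with hD
  set E := P.coeffAxial c with hE
  set G := P.coeffSphere c with hG
  have hDc : Continuous D := hR.continuous_density
  have hEc : Continuous E := hR.continuous_coeffAxial
  have hGc : Continuous G := hR.continuous_coeffSphere
  have hDp : ∀ t, 0 < D t := hR.density_pos
  have hEp : ∀ t, 0 < E t := hR.coeffAxial_pos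
  have hGp : ∀ t, 0 < G t := hR.coeffSphere_pos
  have hψp := J.pos
  have hψc : Continuous ψ := continuous_iff_continuousAt.2 fun t => (J.hasDerivAt t).continuousAt
  have hψ'c := J.continuous_deriv
  have hVc := J.continuous_potential
  -- `B` is strictly decreasing and is controlled by the growth condition. `B'` denotes minus its
  -- derivative, hence is positive, and `B' ≤ 2 B` is what bounds the weight by `2`.
  let B : ℝ → ℝ := fun t => (1 + Real.exp (2 * t))⁻¹
  let B' : ℝ → ℝ := fun t => 2 * Real.exp (2 * t) / (1 + Real.exp (2 * t)) ^ 2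
  have hXp : ∀ t : ℝ, 0 < 1 + Real.exp (2 * t) := fun t => by positivity
  have hX0 : ∀ t : ℝ, 1 + Real.exp (2 * t) ≠ 0 := fun t => (hXp t).ne'
  have hX20 : ∀ t : ℝ, (1 + Real.exp (2 * t)) ^ 2 ≠ 0 := fun t => (pow_pos (hXp t) 2).ne'
  have hBc : Continuous B := by fun_prop (disch := assumption)
  have hB'c : Continuous B' := by fun_prop (disch := assumption)
  have hBp : ∀ t, 0 < B t := fun t => inv_pos.2 (hXp t)
  have hB'p : ∀ t, 0 < B' t := fun t => by simp only [B']; positivity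
  have hB' : ∀ t, HasDerivAt (fun t => -B t) (B' t) t := fun t => by
    have h1 := ((((hasDerivAt_id t).const_mul 2).exp).const_add 1).fun_inv (hX0 t)
    refine h1.fun_neg.congr_deriv ?_
    simp only [B', id]
    ring
  have hB'le : ∀ t, B' t ≤ 2 * B t := fun t => by
    simp only [B', B]
    rw [div_le_iff₀ (pow_pos (hXp t) 2)]
    have := hXp t
    field_simp
    linarith
  have hB1 : ∀ t, B t ≤ C * (D t / E t * ψ t ^ 2) := fun t => by
    rw [inv_le_iff_one_le_mul₀ (hXp t)]
    linarith [(hgrow t).1]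
  have hB2 : ∀ t, B t ≤ C * (D t * ψ t ^ 2) := fun t => by
    rw [inv_le_iff_one_le_mul₀ (hXp t)]
    linarith [(hgrow t).2]
  have hden : ∀ t, 0 < C * (D t * ψ t ^ 2) := fun t => (hBp t).trans_le (hB2 t)
  refine ⟨fun t => B' t / (C * (D t * ψ t ^ 2)), ?_, fun t => div_pos (hB'p t) (hden t),
    fun t => ?_, ?_⟩
  · exact hB'c.div (continuous_const.mul (hDc.mul (hψc.pow 2))) fun t => (hden t).ne'
  · rw [div_le_iff₀ (hden t)]
    linarith [hB'le t, hB2 t]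
  intro ε θ hθ Ω hΩ U ⟨hU, hUc, hUs⟩
  have hs : ∀ p ∈ tsupport (fun p : Cyl n => U p.incl), 0 < inner ℝ θ p.incl.2 :=
    fun p hp => interior_subset_halfSpace hR hθ hΩ (hUs hp)
  set u : Cyl n → ℝ := fun p => U p.incl with hu
  set d1 : Cyl n → ℝ := fun p => fderiv ℝ (lift U) p.incl (1, 0) with hd1
  have hu0 : ∀ p ∉ tsupport u, u p = 0 := fun p hp => image_eq_zero_of_notMem_tsupport hp
  have huc : Continuous u := hU.continuous.comp continuous_incl
  have hd1c : Continuous d1 := (continuous_fderiv_lift hU).clm_apply continuous_const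
  let q : ℝ → ℝ := fun t => ((n - 1) / G t - V t) * D t
  have hqc : Continuous q :=
    ((continuous_const.div hGc fun t => (hGp t).ne').sub hVc).mul hDc
  let Z : ℝ → ℝ := fun t => D t / E t * ψ' t
  have hDEc : Continuous fun t => D t / E t := hDc.div hEc fun t => (hEp t).ne'
  have hZc : Continuous Z := hDEc.mul hψ'c
  -- The quantity to be integrated away is `(k u²)'`: the term `p ψ' / ψ` is Picone's, and `(ε / C)
  -- B / ψ²` comes from the cross term in `B (v' - ε v)²`.
  let k : ℝ → ℝ := fun t => Z t / ψ t - ε / C * (-B t / ψ t ^ 2)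
  let k' : ℝ → ℝ := fun t => (q t * ψ t * ψ t - Z t * ψ' t) / ψ t ^ 2
    - ε / C * ((B' t * ψ t ^ 2 - -B t * (2 * ψ t * ψ' t)) / (ψ t ^ 2) ^ 2)
  have hψ0 : ∀ t, ψ t ≠ 0 := fun t => (hψp t).ne'
  have hψ20 : ∀ t, ψ t ^ 2 ≠ 0 := fun t => (pow_pos (hψp t) 2).ne'
  have hψ40 : ∀ t, (ψ t ^ 2) ^ 2 ≠ 0 := fun t => (pow_pos (pow_pos (hψp t) 2) 2).ne'
  have hkc : Continuous k := by fun_prop (disch := assumption)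
  have hk'c : Continuous k' := by fun_prop (disch := assumption)
  have hk : ∀ t, HasDerivAt k (k' t) t := fun t => by
    have h1 := (J.equation t).fun_div (J.hasDerivAt t) (hψ0 t)
    have h2 := ((hB' t).fun_div ((J.hasDerivAt t).fun_pow 2) (hψ20 t)).const_mul (ε / C)
    refine (h1.fun_sub h2).congr_deriv ?_
    simp [k', q, Z, hD, hE, hG]
  have hcax : Continuous fun p : Cyl n => k' p.1 * u p ^ 2 + k p.1 * (2 * u p * d1 p) :=
    ((hk'c.comp continuous_fst).mul (huc.pow 2)).add
      ((hkc.comp continuous_fst).mul ((continuous_const.mul huc).mul hd1c))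
  have hint : ∀ {g : Cyl n → ℝ}, Continuous g → (∀ p ∉ tsupport u, g p = 0) →
      Integrable g (cylVolume n) := fun hg h0 =>
    hg.integrable_of_hasCompactSupport (HasCompactSupport.intro hUc.isCompact h0)
  have hax : ∫ p, (k' p.1 * u p ^ 2 + k p.1 * (2 * u p * d1 p)) ∂(cylVolume n) = 0 := by
    refine integral_axial_deriv_eq_zero (f := fun p => k p.1 * u p ^ 2) ?_ ?_ ?_ ?_ ?_
    · exact (hkc.comp continuous_fst).mul (huc.pow 2)
    · exact hcax
    · exact HasCompactSupport.intro hUc.isCompact fun p hp => by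
        simp [hu0 p hp]
    · exact HasCompactSupport.intro hUc.isCompact fun p hp => by
        simp [hu0 p hp]
    · intro p
      have h1 : HasDerivAt (fun t => u (t, p.2)) (d1 p) p.1 := by
        have h2 := ((contDiffAt_lift hU (incl_snd_ne_zero p)).differentiableAt
          (by simp)).hasFDerivAt
        have h3 : HasDerivAt (fun t : ℝ => ((t, p.incl.2) : Amb n)) (1, 0) p.1 :=
          (hasDerivAt_id p.1).prodMk (hasDerivAt_const p.1 p.incl.2)
        have h4 := HasFDerivAt.comp_hasDerivAt (f := fun t : ℝ => ((t, p.incl.2) : Amb n)) p.1 h2 h3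
        refine h4.congr_of_eventuallyEq (Eventually.of_forall fun t => ?_)
        exact (lift_incl ((t, p.2) : Cyl n)).symm
      refine ((hk p.1).fun_mul (h1.fun_pow 2)).congr_deriv ?_
      simp
  have hpc : Continuous (picone θ U) := continuous_picone hU hs
  have hDG : Continuous fun p : Cyl n => D p.1 / G p.1 :=
    (hDc.comp continuous_fst).div (hGc.comp continuous_fst) fun p => (hGp _).ne'
  have hi2 : Integrable (fun p : Cyl n => D p.1 / G p.1 * (picone θ U p - (n - 1) * u p ^ 2))
      (cylVolume n) :=
    hint (hDG.mul (hpc.sub (continuous_const.mul (huc.pow 2)))) fun p hp => by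
      simp [hu0 p hp, picone_eq_zero (θ := θ) hp]
  have hsph : ∫ p, D p.1 / G p.1 * (picone θ U p - (n - 1) * u p ^ 2) ∂(cylVolume n) = 0 := by
    rw [integral_prod _ hi2]
    have : ∀ t, ∫ w, D t / G t * (picone θ U (t, w) - (n - 1) * u (t, w) ^ 2)
        ∂(volume : Measure (EuclideanSpace ℝ (Fin n))).toSphere = 0 := fun t => by
      have hsl : Continuous fun w : Metric.sphere (0 : EuclideanSpace ℝ (Fin n)) 1 => (t, w) := by
        fun_prop
      rw [integral_const_mul, integral_sub, integral_picone hU hUc hs t, integral_const_mul,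
        sub_self, mul_zero]
      · exact (hpc.comp hsl).integrable_of_hasCompactSupport
          (HasCompactSupport.of_compactSpace _)
      · exact (continuous_const.mul ((huc.comp hsl).pow 2)).integrable_of_hasCompactSupport
          (HasCompactSupport.of_compactSpace _)
    simp [this]
  rw [stabilityForm, hR.integral_area, hR.integral_area]
  simp only [hR.covectorNormSq_fderiv hU, J.potential, ← hD, ← hE, ← hG]
  have hcov : Continuous fun p : Cyl n => ∑ j, fderiv ℝ (lift U) p.incl
      (0, EuclideanSpace.basisFun (Fin n) ℝ j) ^ 2 :=
    continuous_finsetSum _ fun j _ =>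
      ((continuous_fderiv_lift hU).clm_apply continuous_const).pow 2
  have hi0 : Integrable (fun p : Cyl n => D p.1 * ((ε * (B' p.1 / (C * (D p.1 * ψ p.1 ^ 2)))
      - ε ^ 2) * u p ^ 2)) (cylVolume n) := by
    have h1 : Continuous fun t => B' t / (C * (D t * ψ t ^ 2)) :=
      hB'c.div (continuous_const.mul (hDc.mul (hψc.pow 2))) fun t => (hden t).ne'
    exact hint ((hDc.comp continuous_fst).mul ((((continuous_const.mul h1).sub
      continuous_const).comp continuous_fst).mul (huc.pow 2))) fun p hp => by simp [hu0 p hp]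
  have hi1 : Integrable (fun p : Cyl n => k' p.1 * u p ^ 2 + k p.1 * (2 * u p * d1 p))
      (cylVolume n) := hint hcax fun p hp => by simp [hu0 p hp]
  have hi3 : Integrable (fun p : Cyl n => D p.1 * (d1 p ^ 2 / E p.1 + (∑ j, fderiv ℝ (lift U) p.incl
      (0, EuclideanSpace.basisFun (Fin n) ℝ j) ^ 2) / G p.1 - V p.1 * u p ^ 2)) (cylVolume n) := by
    refine hint ((hDc.comp continuous_fst).mul ((((hd1c.pow 2).div (hEc.comp continuous_fst)
      fun p => (hEp _).ne').add (hcov.div (hGc.comp continuous_fst) fun p => (hGp _).ne')).sub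
      ((hVc.comp continuous_fst).mul (huc.pow 2)))) fun p hp => ?_
    simp [hu0 p hp, hd1, fderiv_lift_eq_zero hUc hp]
  have hi01 : Integrable (fun p : Cyl n => D p.1 * ((ε * (B' p.1 / (C * (D p.1 * ψ p.1 ^ 2)))
      - ε ^ 2) * u p ^ 2) + (k' p.1 * u p ^ 2 + k p.1 * (2 * u p * d1 p))) (cylVolume n) :=
    hi0.add hi1
  -- Two terms of integral zero are added, the axial total derivative and the spherical divergence
  -- defect. After that the inequality holds pointwise.
  calc _ = ∫ p, (D p.1 * ((ε * (B' p.1 / (C * (D p.1 * ψ p.1 ^ 2))) - ε ^ 2) * u p ^ 2)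
        + (k' p.1 * u p ^ 2 + k p.1 * (2 * u p * d1 p))
        + D p.1 / G p.1 * (picone θ U p - (n - 1) * u p ^ 2)) ∂(cylVolume n) := by
        rw [integral_add hi01 hi2, integral_add hi0 hi1, hax, hsph, add_zero, add_zero]
    _ ≤ _ := by
        refine integral_mono (hi01.add hi2) hi3 fun p => ?_
        have h1 := axial_picone (u := u p) (u' := d1 p) (ψ' := ψ' p.1) (q := q p.1) (B' := B' p.1)
          (ε := ε) (hψp p.1) hC (hB1 p.1) (hB2 p.1) (hBp p.1).le
        have h2 := mul_le_mul_of_nonneg_left (picone_le (θ := θ) hU p)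
          (div_pos (hDp p.1) (hGp p.1)).le
        have h3 := (hDp p.1).ne'
        have h4 : D p.1 * (ε * (B' p.1 / (C * (D p.1 * ψ p.1 ^ 2))) - ε ^ 2)
            = ε * (B' p.1 / (C * ψ p.1 ^ 2)) - ε ^ 2 * D p.1 := by
          have := hψ0 p.1
          field_simp
        simp only [k, k', Z, q] at h1 ⊢
        rw [← mul_assoc, h4]
        have h5 : D p.1 * (d1 p ^ 2 / E p.1 + (∑ j, fderiv ℝ (lift U) p.incl
            (0, EuclideanSpace.basisFun (Fin n) ℝ j) ^ 2) / G p.1 - V p.1 * u p ^ 2)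
            = D p.1 / E p.1 * d1 p ^ 2 + D p.1 / G p.1 * (∑ j, fderiv ℝ (lift U) p.incl
            (0, EuclideanSpace.basisFun (Fin n) ℝ j) ^ 2) - D p.1 * V p.1 * u p ^ 2 := by ring
        rw [h5]
        have h6 : D p.1 / G p.1 * (picone θ U p - (n - 1) * u p ^ 2)
          = D p.1 / G p.1 * picone θ U p - (n - 1) / G p.1 * D p.1 * u p ^ 2 := by ring
        rw [h6]
        nlinarith

/-! ### Passage from test functions to `H¹₀` -/

section Limit

/-- For bounded `m` the integral is the inner product `⟨f, m f⟩` in `L²`, which is continuous in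
`f`. That `g` is in `L²` is part of the conclusion because the weak differential in `MemH10` is only
assumed measurable. -/
lemma tendsto_integral_mul_sq {α : Type*} [MeasurableSpace α] {μ : Measure α} {f : ℕ → α → ℝ}
    {g m : α → ℝ} {C : ℝ} (hf : ∀ k, MemLp (f k) 2 μ) (hg : AEStronglyMeasurable g μ)
    (h : Tendsto (fun k => ∫⁻ x, ENNReal.ofReal ((f k x - g x) ^ 2) ∂μ) atTop (𝓝 0))
    (hm : AEStronglyMeasurable m μ) (hC : ∀ x, |m x| ≤ C) :
    MemLp g 2 μ ∧ Tendsto (fun k => ∫ x, m x * f k x ^ 2 ∂μ) atTop (𝓝 (∫ x, m x * g x ^ 2 ∂μ)) := by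
  have hn : ∀ k, eLpNorm (f k - g) 2 μ
      = (∫⁻ x, ENNReal.ofReal ((f k x - g x) ^ 2) ∂μ) ^ (1 / 2 : ℝ) := fun k => by
    rw [eLpNorm_eq_lintegral_rpow_enorm_toReal (by simp) (by simp)]
    simp only [ENNReal.toReal_ofNat, ENNReal.rpow_ofNat, Pi.sub_apply]
    congr 2
    funext x
    rw [← sq_abs, ENNReal.ofReal_pow (abs_nonneg _), Real.enorm_eq_ofReal_abs]
  have hlim : Tendsto (fun k => eLpNorm (f k - g) 2 μ) atTop (𝓝 0) := by
    have := (ENNReal.continuous_rpow_const (y := (1 / 2 : ℝ))).tendsto 0 |>.comp h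
    simp only [hn]
    simpa [Function.comp_def] using this
  have hgL : MemLp g 2 μ := by
    obtain ⟨k, hk⟩ := (hlim.eventually (gt_mem_nhds ENNReal.zero_lt_top)).exists
    have h1 : MemLp (f k - g) 2 μ := ⟨(hf k).1.sub hg, hk⟩
    simpa using (hf k).sub h1
  have hmul : ∀ {v : α → ℝ}, MemLp v 2 μ → MemLp (fun x => m x * v x) 2 μ := fun {v} hv =>
    hv.of_le_mul (c := C) (hm.mul hv.1) (Eventually.of_forall fun x => by
      rw [norm_mul]
      exact mul_le_mul_of_nonneg_right (hC x) (norm_nonneg _))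
  refine ⟨hgL, ?_⟩
  have h1 : Tendsto (fun k => (hf k).toLp (f k)) atTop (𝓝 (hgL.toLp g)) :=
    (Lp.tendsto_Lp_iff_tendsto_eLpNorm'' _ hf _ hgL).2 hlim
  have h2 : Tendsto (fun k => (hmul (hf k)).toLp _) atTop (𝓝 ((hmul hgL).toLp _)) := by
    rw [Lp.tendsto_Lp_iff_tendsto_eLpNorm'' _ (fun k => hmul (hf k)) _ (hmul hgL)]
    have h3 : Tendsto (fun k => ENNReal.ofReal C * eLpNorm (f k - g) 2 μ) atTop (𝓝 0) := by
      simpa using ENNReal.Tendsto.const_mul hlim (Or.inr ENNReal.ofReal_ne_top)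
    refine tendsto_of_tendsto_of_tendsto_of_le_of_le tendsto_const_nhds h3 (fun _ => zero_le)
      fun k => ?_
    refine eLpNorm_le_mul_eLpNorm_of_ae_le_mul (Eventually.of_forall fun x => ?_) 2
    simp only [Pi.sub_apply]
    rw [← mul_sub, norm_mul]
    exact mul_le_mul_of_nonneg_right (hC x) (norm_nonneg _)
  have h3 := h1.inner h2 (𝕜 := ℝ)
  have h4 : ∀ {v : α → ℝ} (hv : MemLp v 2 μ),
      inner ℝ (hv.toLp v) ((hmul hv).toLp _) = ∫ x, m x * v x ^ 2 ∂μ := fun {v} hv => by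
    rw [L2.inner_def]
    refine integral_congr_ae ?_
    filter_upwards [hv.coeFn_toLp, (hmul hv).coeFn_toLp] with x hx hx'
    rw [hx, hx']
    simp
    ring
  simpa only [h4] using h3

variable {n : ℕ} {c : SpaceForm} {P : Profile}

/-- The normalized components of a covector whose squares add up to its squared norm. -/
def component (c : SpaceForm) (P : Profile) (p : Cyl n) (η : Amb n →L[ℝ] ℝ) : Option (Fin n) → ℝ
  | none => η (1, 0) / √(P.coeffAxial c p.1)
  | some j => η (0, tang p.incl.2 (EuclideanSpace.basisFun (Fin n) ℝ j)) / √(P.coeffSphere c p.1)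

lemma Profile.Regular.covectorNormSq_eq_sum (h : P.Regular c) (p : Cyl n) (η : Amb n →L[ℝ] ℝ) :
    covectorNormSq c P p η = ∑ i, component c P p η i ^ 2 := by
  rw [h.covectorNormSq_eq, Fintype.sum_option]
  simp only [component, div_pow, Real.sq_sqrt (h.coeffAxial_pos _).le,
    Real.sq_sqrt (h.coeffSphere_pos _).le, Finset.sum_div]

lemma component_sub (p : Cyl n) (η ζ : Amb n →L[ℝ] ℝ) (i : Option (Fin n)) :
    component c P p (η - ζ) i = component c P p η i - component c P p ζ i := by
  cases i <;> simp [component, sub_div]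

lemma Profile.Regular.aestronglyMeasurable_component (h : P.Regular c)
    {η : Cyl n → Amb n →L[ℝ] ℝ} {μ : Measure (Cyl n)} (hη : AEStronglyMeasurable η μ)
    (i : Option (Fin n)) : AEStronglyMeasurable (fun p => component c P p (η p) i) μ := by
  have key : ∀ {v : Cyl n → Amb n} {e : ℝ → ℝ}, Continuous v → Continuous e →
      AEStronglyMeasurable (fun p => η p (v p) / √(e p.1)) μ := fun hv he => by
    have h1 : Continuous fun q : (Amb n →L[ℝ] ℝ) × Amb n => q.1 q.2 :=
      isBoundedBilinearMap_apply.continuous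
    have h2 := h1.comp_aestronglyMeasurable (hη.prodMk hv.aestronglyMeasurable)
    exact h2.div₀ (Real.continuous_sqrt.comp (he.comp continuous_fst)).aestronglyMeasurable
  cases i with
  | none => exact key continuous_const h.continuous_coeffAxial
  | some j =>
    refine key (continuous_const.prodMk ?_) h.continuous_coeffSphere
    have h1 : Continuous fun p : Cyl n => p.incl.2 := continuous_snd.comp continuous_incl
    have h2 : Continuous fun p : Cyl n =>
        inner ℝ p.incl.2 (EuclideanSpace.basisFun (Fin n) ℝ j) := h1.inner continuous_const
    exact continuous_const.sub (h2.smul h1)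

lemma IsTest.memLp (h : P.Regular c) {Ω : Set (Amb n)} {U : Amb n → ℝ} (hU : IsTest P Ω U) :
    MemLp (fun p : Cyl n => U p.incl) 2 (area n c P) := by
  have hc : Continuous fun p : Cyl n => U p.incl := hU.1.continuous.comp continuous_incl
  rw [memLp_two_iff_integrable_sq hc.aestronglyMeasurable]
  exact h.integrable_area (hc.pow 2) (HasCompactSupport.intro hU.2.1.isCompact fun p hp => by
    have : U p.incl = 0 := image_eq_zero_of_notMem_tsupport (f := fun p : Cyl n => U p.incl) hp
    simp [this])

lemma IsTest.memLp_component (h : P.Regular c) {Ω : Set (Amb n)} {U : Amb n → ℝ}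
    (hU : IsTest P Ω U) (i : Option (Fin n)) :
    MemLp (fun p : Cyl n => component c P p (fderiv ℝ U p.incl) i) 2 (area n c P) := by
  -- Only tangential derivatives enter the components, so `U` may be replaced by `lift U`. The
  -- differential of the lift vanishes off the support of the restriction, whereas that of `U` may
  -- keep a normal part.
  have key : ∀ {v : Amb n} {e : ℝ → ℝ}, Continuous e → (∀ t, 0 < e t) →
      MemLp (fun p : Cyl n => fderiv ℝ (lift U) p.incl v / √(e p.1)) 2 (area n c P) := by
    intro v e he hp
    have hc : Continuous fun p : Cyl n => fderiv ℝ (lift U) p.incl v / √(e p.1) :=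
      ((continuous_fderiv_lift hU.1).clm_apply continuous_const).div
        (Real.continuous_sqrt.comp (he.comp continuous_fst)) fun p => (Real.sqrt_pos.2 (hp _)).ne'
    rw [memLp_two_iff_integrable_sq hc.aestronglyMeasurable]
    exact h.integrable_area (hc.pow 2) (HasCompactSupport.intro hU.2.1.isCompact fun p hp => by
      simp [fderiv_lift_eq_zero hU.2.1 hp])
  cases i with
  | none =>
    refine (memLp_congr_ae (Eventually.of_forall fun p => ?_)).1
      (key (v := (1, 0)) h.continuous_coeffAxial h.coeffAxial_pos)
    simp [component, fderiv_lift hU.1, tang]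
  | some j =>
    refine (memLp_congr_ae (Eventually.of_forall fun p => ?_)).1
      (key (v := (0, EuclideanSpace.basisFun (Fin n) ℝ j)) h.continuous_coeffSphere
        h.coeffSphere_pos)
    simp [component, fderiv_lift hU.1]

/-- Lower bounds for the stability form extend from test functions to `H¹₀`. -/
theorem IsJacobiFactor.le_stabilityForm {V ψ ψ' : ℝ → ℝ} (J : IsJacobiFactor n c P V ψ ψ')
    {Ω : Set (Amb n)} {a : ℝ → ℝ} {C : ℝ} (ha : Continuous a) (hC : ∀ t, |a t| ≤ C)
    (hle : ∀ U, IsTest P Ω U → ∫ p, a p.1 * U p.incl ^ 2 ∂(area n c P)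
      ≤ stabilityForm c P (fun p => U p.incl) (fun p => fderiv ℝ U p.incl))
    {u : Cyl n → ℝ} {η : Cyl n → Amb n →L[ℝ] ℝ} (hu : MemH10 c P Ω u η) :
    ∫ p, a p.1 * u p ^ 2 ∂(area n c P) ≤ stabilityForm c P u η := by
  obtain ⟨hu2, hη, U, hU, hUu, hUη⟩ := hu
  have hR := J.regular
  obtain ⟨M, hM⟩ := J.bounded
  have hV : AEStronglyMeasurable (fun p : Cyl n => V p.1) (area n c P) :=
    (J.continuous_potential.comp continuous_fst).aestronglyMeasurable
  have haM : AEStronglyMeasurable (fun p : Cyl n => a p.1) (area n c P) :=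
    (ha.comp continuous_fst).aestronglyMeasurable
  have hUL := fun k => (hU k).memLp hR
  have hUcL := fun k => (hU k).memLp_component hR
  have hcη := hR.aestronglyMeasurable_component hη
  have hcomp : ∀ i, Tendsto (fun k => ∫⁻ p, ENNReal.ofReal
      ((component c P p (fderiv ℝ (U k) p.incl) i - component c P p (η p) i) ^ 2) ∂(area n c P))
      atTop (𝓝 0) := fun i =>
    tendsto_of_tendsto_of_tendsto_of_le_of_le tendsto_const_nhds hUη (fun _ => zero_le) fun k =>
      lintegral_mono fun p => ENNReal.ofReal_le_ofReal (by
        rw [← component_sub, hR.covectorNormSq_eq_sum]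
        exact Finset.single_le_sum (f := fun i => component c P p (fderiv ℝ (U k) p.incl - η p) i ^ 2)
          (fun _ _ => sq_nonneg _) (Finset.mem_univ i))
  have hone : AEStronglyMeasurable (fun _ : Cyl n => (1 : ℝ)) (area n c P) :=
    aestronglyMeasurable_const
  have hL := fun i => tendsto_integral_mul_sq (fun k => hUcL k i) (hcη i) (hcomp i) hone
    (C := 1) (by simp)
  -- Splitting the form into finitely many weighted squared norms needs each piece integrable.
  -- Boundedness of `V` supplies this for the potential term.
  have hint : ∀ {v : Cyl n → ℝ} {ζ : Cyl n → Amb n →L[ℝ] ℝ}, MemLp v 2 (area n c P) →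
      (∀ i, MemLp (fun p => component c P p (ζ p) i) 2 (area n c P)) →
      stabilityForm c P v ζ = (∑ i, ∫ p, 1 * component c P p (ζ p) i ^ 2 ∂(area n c P))
        - ∫ p, V p.1 * v p ^ 2 ∂(area n c P) := by
    intro v ζ hv hζ
    have h1 : Integrable (fun p => V p.1 * v p ^ 2) (area n c P) :=
      hv.integrable_sq.bdd_mul hV (Eventually.of_forall fun p => hM p.1)
    simp only [stabilityForm, hR.covectorNormSq_eq_sum, J.potential, one_mul]
    rw [integral_sub (integrable_finsetSum _ fun i _ => (hζ i).integrable_sq) h1,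
      integral_finsetSum _ fun i _ => (hζ i).integrable_sq]
  have hlimV := (tendsto_integral_mul_sq hUL hu2.1 hUu hV (fun p => hM p.1)).2
  have hlima := (tendsto_integral_mul_sq hUL hu2.1 hUu haM (fun p => hC p.1)).2
  have hlim := (tendsto_finsetSum Finset.univ fun i _ => (hL i).2).sub hlimV
  rw [hint hu2 fun i => (hL i).1]
  refine le_of_tendsto_of_tendsto' hlima hlim fun k => ?_
  rw [← hint (hUL k) (hUcL k)]
  exact hle _ (hU k)

end Limit

/-! ### Positive definiteness and the spectral gap -/

section Positivity
variable {n : ℕ} {c : SpaceForm} {P : Profile}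

/-- The axial parameter is bounded on a relatively compact piece of an unduloid. -/
lemma IsDelaunayUnduloid.exists_bound {H μ : ℝ} (hP : IsDelaunayUnduloid n c H μ P)
    {Ω : Set (Amb n)} (hΩ : RelativelyCompact P Ω) :
    ∃ T, ∀ p : Cyl n, P.param p.incl ∈ Ω → |p.1| ≤ T := by
  obtain ⟨K, hK, hKP, hΩK⟩ := hΩ
  obtain ⟨-, hprof, -⟩ := hP
  cases c with
  | euclidean =>
    obtain ⟨-, f, -, -, rfl, -⟩ := hprof
    obtain ⟨T, hT⟩ := hK.exists_bound_of_continuousOn (f := fun q : Amb n => q.1)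
      continuous_fst.continuousOn
    exact ⟨T, fun p hp => hT _ (hΩK hp)⟩
  | hyperbolic =>
    obtain ⟨-, φ, -, -, rfl, -⟩ := hprof
    -- The parameter `t` is the logarithm of the Euclidean distance to the origin, a continuous
    -- function on the compact set.
    have hsq : ∀ p : Cyl n, ((hyperbolicProfile φ).param p.incl).1 ^ 2
        + ‖((hyperbolicProfile φ).param p.incl).2‖ ^ 2 = Real.exp (2 * p.1) := fun p => by
      have h1 : ‖p.incl.2‖ = 1 := by simp [Cyl.incl]
      have h2 : p.incl.1 = p.1 := rfl
      simp only [Profile.param, hyperbolicProfile, norm_smul, h1, h2, mul_one, Real.norm_eq_abs,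
        sq_abs, mul_pow, ← mul_add, Real.cos_sq_add_sin_sq]
      rw [← Real.exp_nat_mul]
      norm_num
    have hcont : ContinuousOn (fun q : Amb n => Real.log (q.1 ^ 2 + ‖q.2‖ ^ 2)) K := by
      refine ContinuousOn.log (by fun_prop) fun q hq => ?_
      obtain ⟨p, rfl⟩ := hKP hq
      simp only [hsq]
      exact (Real.exp_pos _).ne'
    obtain ⟨T, hT⟩ := hK.exists_bound_of_continuousOn hcont
    refine ⟨T / 2, fun p hp => ?_⟩
    have := hT _ (hΩK hp)
    simp only [hsq, Real.log_exp, norm_mul, Real.norm_eq_abs] at this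
    norm_num at this
    linarith

theorem IsJacobiFactor.dirichletPositive [NeZero n] {V ψ ψ' : ℝ → ℝ}
    (J : IsJacobiFactor n c P V ψ ψ') {H μ : ℝ} (hP : IsDelaunayUnduloid n c H μ P)
    {θ : EuclideanSpace ℝ (Fin n)} (hθ : θ ≠ 0) {Ω : Set (Amb n)} (hΩ : Ω ⊆ halfSpace θ) :
    DirichletPositive c P Ω := by
  obtain ⟨ρ, hρc, hρp, hρ2, hle⟩ := J.exists_weight
  have hρa : ∀ t, |ρ t| ≤ 2 := fun t => (abs_of_pos (hρp t)).trans_le (hρ2 t)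
  refine ⟨fun u η hu hne => ?_, fun hcpt => ?_⟩
  · have hu2 : Integrable (fun p => u p ^ 2) (area n c P) := hu.1.integrable_sq
    have hρu : Integrable (fun p => ρ p.1 * u p ^ 2) (area n c P) :=
      hu2.bdd_mul (hρc.comp continuous_fst).aestronglyMeasurable
        (Eventually.of_forall fun p => hρa p.1)
    have key : ∀ ε : ℝ, ε * ∫ p, ρ p.1 * u p ^ 2 ∂(area n c P)
        - ε ^ 2 * ∫ p, u p ^ 2 ∂(area n c P) ≤ stabilityForm c P u η := fun ε => by
      have h1 := J.le_stabilityForm (a := fun t => ε * ρ t - ε ^ 2) (C := |ε| * 2 + ε ^ 2)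
        (by fun_prop) (fun t => by
          refine (abs_sub _ _).trans ?_
          rw [abs_mul, abs_of_nonneg (sq_nonneg ε)]
          gcongr
          exact hρa t) (hle ε θ hθ Ω hΩ) hu
      rw [← integral_const_mul, ← integral_const_mul,
        ← integral_sub (hρu.const_mul _) (hu2.const_mul _)]
      simpa only [sub_mul, mul_assoc] using h1
    have hpos : 0 < ∫ p, ρ p.1 * u p ^ 2 ∂(area n c P) := by
      have h0 : 0 ≤ fun p : Cyl n => ρ p.1 * u p ^ 2 := fun p =>
        mul_nonneg (hρp _).le (sq_nonneg _)
      refine lt_of_le_of_ne (integral_nonneg h0) fun h => hne ?_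
      filter_upwards [(integral_eq_zero_iff_of_nonneg h0 hρu).1 h.symm] with p hp
      simpa [(hρp p.1).ne'] using hp
    set A := ∫ p, ρ p.1 * u p ^ 2 ∂(area n c P)
    set B := ∫ p, u p ^ 2 ∂(area n c P)
    have hB : 0 ≤ B := integral_nonneg fun p => sq_nonneg _
    -- The value of `ε` is close to the maximizer `A / (2 B)` of `ε A - ε² B` up to constants when
    -- `B` is large. The `+ 1` keeps the denominator positive, and the resulting bound is `(A / (B +
    -- 1))²`.
    refine lt_of_lt_of_le ?_ (key (A / (B + 1)))
    have : A / (B + 1) * A - (A / (B + 1)) ^ 2 * B = A ^ 2 / (B + 1) ^ 2 := by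
      field_simp
      ring
    rw [this]
    positivity
  · obtain ⟨T, hT⟩ := hP.exists_bound hcpt
    obtain ⟨r, hr, hrρ⟩ : ∃ r, 0 < r ∧ ∀ t, |t| ≤ T → r ≤ ρ t := by
      -- A negative bound `T` can occur only when no parameter lands in `Ω`; the lower bound on `ρ`
      -- is then vacuous.
      obtain hTn | hT0 := lt_or_ge T 0
      · exact ⟨1, one_pos, fun t ht => absurd ((abs_nonneg t).trans ht) hTn.not_ge⟩
      · obtain ⟨t₀, -, h⟩ := isCompact_Icc.exists_isMinOn (s := Set.Icc (-T) T)
          ⟨0, by simpa using hT0⟩ hρc.continuousOn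
        exact ⟨ρ t₀, hρp _, fun t ht => h (abs_le.1 ht)⟩
    -- With `ε = r / 2` and `ρ ≥ r` on the support, `ε ρ - ε² ≥ r² / 2 - r² / 4 = (r / 2)²`.
    refine ⟨(r / 2) ^ 2, by positivity, fun u η hu => ?_⟩
    have h1 := J.le_stabilityForm (a := fun _ => (r / 2) ^ 2) continuous_const (fun _ => le_rfl)
      (fun U hU => le_trans ?_ (hle (r / 2) θ hθ Ω hΩ U hU)) hu
    · rwa [integral_const_mul] at h1
    have hU2 : Integrable (fun p : Cyl n => U p.incl ^ 2) (area n c P) :=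
      (hU.memLp J.regular).integrable_sq
    refine integral_mono (hU2.const_mul _) ?_ fun p => ?_
    · refine hU2.bdd_mul (c := |r / 2| * 2 + (r / 2) ^ 2)
        (((continuous_const.mul hρc).sub continuous_const).comp
          continuous_fst).aestronglyMeasurable (Eventually.of_forall fun p => ?_)
      refine (abs_sub _ _).trans ?_
      rw [abs_mul, abs_of_nonneg (sq_nonneg (r / 2))]
      gcongr
      exact hρa _
    · by_cases hp : p ∈ tsupport fun p : Cyl n => U p.incl
      · have h2 := hrρ p.1 (hT p (interior_subset (s := {p : Cyl n | P.param p.incl ∈ Ω})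
          (hU.2.2 hp)))
        refine mul_le_mul_of_nonneg_right ?_ (sq_nonneg _)
        nlinarith
      · have : U p.incl = 0 :=
          image_eq_zero_of_notMem_tsupport (f := fun p : Cyl n => U p.incl) hp
        simp [this]

end Positivity

end Delaunay

end

theorem proposition4p1 (n : ℕ) (hn : 2 ≤ n) (c : Delaunay.SpaceForm) (H μ : ℝ)
    (P : Delaunay.Profile) (hP : Delaunay.IsDelaunayUnduloid n c H μ P)
    (θ : EuclideanSpace ℝ (Fin n)) (hθ : θ ≠ 0) :
    (∀ Ω ⊆ P.surface n ∩ Delaunay.halfSpace θ, Delaunay.DirichletPositive c P Ω) ∧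
      Delaunay.StronglyStable c P (P.surface n ∩ Delaunay.halfSpace θ) := by
  have : NeZero n := ⟨by omega⟩
  obtain ⟨V, ψ, ψ', J⟩ := hP.exists_isJacobiFactor hn
  have key : ∀ Ω ⊆ P.surface n ∩ Delaunay.halfSpace θ, Delaunay.DirichletPositive c P Ω :=
    fun Ω hΩ => J.dirichletPositive hP hθ (hΩ.trans Set.inter_subset_right)
  refine ⟨key, fun Ω hΩ hcpt u η hu => ?_⟩
  obtain ⟨l, hl, h⟩ := (key Ω hΩ).2 hcpt
  exact (mul_nonneg hl.le (integral_nonneg fun p => sq_nonneg (u p))).trans (h u η hu)
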